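/- **Setting.** A *program* $P$ consists of typed global variables and finitely many functions, each with its own local variables and formal parameters and with a graph of locations having an entry location (no in-edge) and a different exit location (no out-edge); edges stay inside a function. A location has no out-edge, or one out-edge labelled by an assignment, a call by value $x:=f(\ldots)$ or $f(\ldots)$, a statement $\mathtt{ret}\ e$ (which stores $e$ in the global variable $\mathbf{ret}_f$ of its function $f$) or $\mathtt{skip}$, or two out-edges labelled $\gamma$ and $\neg\gamma$. The starting function is never called, and call edges do not touch entry or exit locations. An *error location* is one whose only out-edge is a $\mathtt{skip}$ loop. *Symbolic expressions* are built by operators from constants, symbols $\Theta(a)$ (one for each program variable $a$) and *parameters*, which range over non-negative integers; boolean ones may quantify parameters. A *symbolic memory* maps variables to symbolic expressions. A *state* is $s=(\theta,\varphi,\Xi,l)$: a memory, a path condition, a call stack and a location. Ordinary stack records consist of the values $\sigma$ of the caller's local variables and the return location (with the destination of the returned value). *Composition:* $\theta\langle\!\langle\varphi\rangle\!\rangle$ replaces each symbol $\Theta(a)$ in $\varphi$ by $\theta(a)$; $(\theta\circ\theta')(a)=\theta\langle\!\langle\theta'(a)\rangle\!\rangle$; $(\theta,\varphi,\Xi,l)\circ(\theta',\varphi',\Xi',l')=(\theta\circ\theta',\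 \varphi\wedge\theta\langle\!\langle\varphi'\rangle\!\rangle,\ \Xi\circ(\theta\circ\Xi'),\ l')$, where $\Xi\circ(\theta\circ\Xi')$ puts the records of $\Xi'$, composed with $\theta$, on top of $\Xi$. *Valuation:* $s\langle\nu\rangle$ replaces every parameter by its integer, and every special stack record $(t,\kappa)$ by $\nu(\kappa)$ records $(\bot,\bot)$, where $(\bot,\bot)$ stands for any record. *Equivalence:* $s\equiv s'$ if the locations are equal, the path conditions are logically equivalent, the memories are equal under every assignment, and the stacks have the same length and pairwise equivalent records; $\overset{g}{\equiv}$ is the same with memories compared on global variables only. *Classic tree.* $T$ is the (possibly infinite) tree with root $(\Theta,\mathrm{true},[],\text{entry of the starting function})$ in which a vertex whose location is the exit of the starting function or an error location has no children, and any other vertex $u$ has as children the states obtained from $u.s$ by executing one out-edge of $u.l$ (a call pushes a record), or, at an exit location, by returning to the top record, whose path condition is satisfiable. *Templates* (of $P$, with one parameter $\kappa$). Let $n>0$, let $s_i=(\theta_i,\varphi_i,\Xi_i,l_i)$ ($1\le i\le n$) be states with no parameter but $\kappa$ and only ordinary stack records, with $\varphi_i$ satisfiable, $\varphi_i\wedge\varphi_j\equiv\mathrm{false}$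 for $i\ne j$, and no $l_i$ an entry or exit location. Say that $w$ is *inside* $u$ (for $w$ a successor of $u$ in $T$) if no vertex from $u$ to $w$ has a shorter call stack than $u$, i.e. the activation of $u$ is not left. - $t=(l,n,\{s_1,\dots,s_n\})$ is a *template* if $l$ is neither an entry nor an exit location; for each path in $T$ from a vertex $u$ with $u.l=l$ to a leaf there are a vertex $w\ne u$ on it that is inside $u$, an $i$ and an integer $\nu\ge0$ with $w.s\equiv u.s\circ s_i\langle\nu\rangle$; and for all $u$ with $u.l=l$, $i$, $\nu\ge 0$ with $u.\varphi\wedge u.\theta\langle\!\langle\varphi_i\langle\nu\rangle\rangle\!\rangle$ satisfiable, $u$ has a successor $w$ in $T$ with $w.s\equiv u.s\circ s_i\langle\nu\rangle$. - $t=(l,n,\{s_1,\dots,s_n\},\theta,l')$ ($\theta$ a memory with no parameter but $\kappa$) is a *recursion template* if, with $\hat s_i=(\theta_i,\varphi_i,[(t,\kappa)]\circ\Xi_i,l_i)$: $l$ and $l'$ are the entry and the exit of one function $f$, which is called somewhere in $P$, and the activation directly above the record $(t,\kappa)$ in $\hat s_i$ is one of $f$ (the bottom record of $\Xi_i$ returns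 into $f$, or $\Xi_i=[]$ and $l_i$ is in $f$); for each path in $T$ from a vertex $u$ with $u.l=l$ to a leaf there are a non-leaf vertex $w\ne u$ on it that is inside $u$, an $i$ and a $\nu\ge0$ with $w.s\equiv u.s\circ\hat s_i\langle\nu\rangle$, such that, if $\bar w$ is the first vertex after $w$ on the path with $\bar w.l=l'$ whose stack is that of $w$ without the records of $\Xi_i$, then some non-leaf vertex $\bar u$ of the path, equal to or after $\bar w$ and inside $u$, satisfies $\bar u.s\overset{g}{\equiv}(\bar w.\theta\circ\theta\langle\nu\rangle,\bar w.\varphi,u.\Xi,l')$; and for all $u$ with $u.l=l$, $i$, $\nu\ge0$ with $u.\varphi\wedge u.\theta\langle\!\langle\varphi_i\langle\nu\rangle\rangle\!\rangle$ satisfiable, $u$ has a successor $w$ in $T$ with $w.s\equiv u.s\circ\hat s_i\langle\nu\rangle$. *Compact tree.* Let $p$ be any set of templates and recursion templates of $P$. A compact tree $T'$ is built like $T$, except that the candidate children of a vertex with state $s$, not at the exit of the starting function nor at an error location, are: (a) if the top record is $(t,\kappa)$ and $s.l=t.l'$: the single state $(s.\theta\circ t.\theta\langle\kappa\rangle,s.\varphi,\mathrm{pop}(s.\Xi),t.l')$;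 (b) otherwise, if some template of $p$ has entry location $s.l$: one such $t$ is chosen arbitrarily, its parameter is renamed to a fresh $\kappa$, and the candidates are $s\circ s_i\langle\kappa\rangle$ (respectively $s\circ\hat s_i\langle\kappa\rangle$ for a recursion template), $i=1,\dots,n$; (c) otherwise the classic successors. Candidates with unsatisfiable path condition are dropped. **Theorem (Soundness).** Let $T$ be the classic symbolic execution tree of a program $P$ and $T'$ a compact symbolic execution tree of $P$ built with a set of templates and recursion templates with one parameter. For every leaf $e$ of $T$ there are a leaf $e'$ of $T'$ and a valuation $\nu$ of the parameters of $e'.s$ such that $e.s\equiv e'.s\langle\nu\rangle$. -/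

import Mathlib

namespace CSE

/-! ### Data types, program variables and symbolic expressions -/

/-- The data types with their operators and predicates, and the typed program variables.
Everything is interpreted: operators are functions and predicates are relations on the values.
`num` is the numeric type in which parameters (non-negative integers) are read. -/
structure Vocab where
  Srt : Type
  Val : Srt → Type
  val_nonempty : ∀ s, Nonempty (Val s)
  num : Srt
  ofNat : ℕ → Val num
  Op : Type
  opArity : Op → ℕ
  opArg : (o : Op) → Fin (opArity o) → Srt
  opRes : Op → Srt
  opEval : (o : Op) → ((i : Fin (opArity o)) → Val (opArg o i)) → Val (opRes o)
  Rel : Type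
  relArity : Rel → ℕ
  relArg : (r : Rel) → Fin (relArity r) → Srt
  relEval : (r : Rel) → ((i : Fin (relArity r)) → Val (relArg r i)) → Prop
  Var : Type
  ty : Var → Srt

/-- Symbolic expressions whose free parameters are taken from `K` and which may use `n`
parameters bound by surrounding quantifiers. `sym a` is the symbol `Θ(a)` of the program
variable `a`. `K = Empty`: no parameter; `K = Unit`: one parameter; `K = ℕ`: any parameters.
An expression over program variables is also represented by this type (with `K = Empty`),
`sym a` standing for the variable `a`. -/
inductive SymExpr (V : Vocab) (K : Type) (n : ℕ) : V.Srt → Type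
  | const {s : V.Srt} (c : V.Val s) : SymExpr V K n s
  | sym (a : V.Var) : SymExpr V K n (V.ty a)
  | param (k : K) : SymExpr V K n V.num
  | bound (i : Fin n) : SymExpr V K n V.num
  | op (o : V.Op) (args : (i : Fin (V.opArity o)) → SymExpr V K n (V.opArg o i)) :
      SymExpr V K n (V.opRes o)

/-- Boolean symbolic expressions; quantifiers range over parameters. -/
inductive BoolExpr (V : Vocab) (K : Type) : ℕ → Type
  | tru {n : ℕ} : BoolExpr V K n
  | eq {n : ℕ} {s : V.Srt} (e e' : SymExpr V K n s) : BoolExpr V K n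
  | rel {n : ℕ} (r : V.Rel) (args : (i : Fin (V.relArity r)) → SymExpr V K n (V.relArg r i)) :
      BoolExpr V K n
  | neg {n : ℕ} (φ : BoolExpr V K n) : BoolExpr V K n
  | and {n : ℕ} (φ ψ : BoolExpr V K n) : BoolExpr V K n
  | all {n : ℕ} (φ : BoolExpr V K (n + 1)) : BoolExpr V K n

/-- Symbolic memories. -/
abbrev Mem (V : Vocab) (K : Type) : Type := (a : V.Var) → SymExpr V K 0 (V.ty a)

/-- The initial symbolic memory `Θ`. -/
def Mem.init (V : Vocab) (K : Type) : Mem V K := fun a => .sym a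

namespace SymExpr

variable {V : Vocab} {K K' : Type}

/-- Value under an assignment of the symbols, the parameters and the bound parameters. -/
def eval {n : ℕ} (ρ : (a : V.Var) → V.Val (V.ty a)) (κ : K → ℕ) (b : Fin n → ℕ) :
    {s : V.Srt} → SymExpr V K n s → V.Val s
  | _, const c => c
  | _, sym a => ρ a
  | _, param k => V.ofNat (κ k)
  | _, bound i => V.ofNat (b i)
  | _, op o args => V.opEval o (fun i => (args i).eval ρ κ b)

/-- Renaming of parameters. -/
def rename {n : ℕ} (f : K → K') : {s : V.Srt} → SymExpr V K n s → SymExpr V K' n s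
  | _, const c => const c
  | _, sym a => sym a
  | _, param k => param (f k)
  | _, bound i => bound i
  | _, op o args => op o (fun i => (args i).rename f)

/-- `e⟨ν⟩`: every parameter is replaced by its integer in `ν`. -/
def value {n : ℕ} (ν : K → ℕ) : {s : V.Srt} → SymExpr V K n s → SymExpr V Empty n s
  | _, const c => const c
  | _, sym a => sym a
  | _, param k => const (V.ofNat (ν k))
  | _, bound i => bound i
  | _, op o args => op o (fun i => (args i).value ν)

/-- An expression without bound parameters, placed under `n` quantifiers. -/
def lift (n : ℕ) : {s : V.Srt} → SymExpr V K 0 s → SymExpr V K n s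
  | _, const c => const c
  | _, sym a => sym a
  | _, param k => param k
  | _, bound i => i.elim0
  | _, op o args => op o (fun i => (args i).lift n)

/-- `θ⟪e⟫`: every symbol `Θ(a)` is replaced by `θ(a)`, simultaneously. -/
def subst {n : ℕ} (θ : Mem V K) : {s : V.Srt} → SymExpr V K n s → SymExpr V K n s
  | _, const c => const c
  | _, sym a => (θ a).lift n
  | _, param k => param k
  | _, bound i => bound i
  | _, op o args => op o (fun i => (args i).subst θ)

/-- Equivalence of expressions. -/
def Equiv {s : V.Srt} (e e' : SymExpr V K 0 s) : Prop :=
  ∀ (ρ : (a : V.Var) → V.Val (V.ty a)) (κ : K → ℕ), e.eval ρ κ Fin.elim0 = e'.eval ρ κ Fin.elim0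

end SymExpr

namespace BoolExpr

variable {V : Vocab} {K K' : Type}

def Holds (ρ : (a : V.Var) → V.Val (V.ty a)) (κ : K → ℕ) :
    {n : ℕ} → (Fin n → ℕ) → BoolExpr V K n → Prop
  | _, _, tru => True
  | _, b, eq e e' => e.eval ρ κ b = e'.eval ρ κ b
  | _, b, rel r args => V.relEval r (fun i => (args i).eval ρ κ b)
  | _, b, neg φ => ¬ φ.Holds ρ κ b
  | _, b, and φ ψ => φ.Holds ρ κ b ∧ ψ.Holds ρ κ b
  | _, b, all φ => ∀ m : ℕ, φ.Holds ρ κ (Fin.snoc b m : Fin (_ + 1) → ℕ)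

def rename (f : K → K') : {n : ℕ} → BoolExpr V K n → BoolExpr V K' n
  | _, tru => tru
  | _, eq e e' => eq (e.rename f) (e'.rename f)
  | _, rel r args => rel r (fun i => (args i).rename f)
  | _, neg φ => neg (φ.rename f)
  | _, and φ ψ => and (φ.rename f) (ψ.rename f)
  | _, all φ => all (φ.rename f)

def value (ν : K → ℕ) : {n : ℕ} → BoolExpr V K n → BoolExpr V Empty n
  | _, tru => tru
  | _, eq e e' => eq (e.value ν) (e'.value ν)
  | _, rel r args => rel r (fun i => (args i).value ν)
  | _, neg φ => neg (φ.value ν)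
  | _, and φ ψ => and (φ.value ν) (ψ.value ν)
  | _, all φ => all (φ.value ν)

def subst (θ : Mem V K) : {n : ℕ} → BoolExpr V K n → BoolExpr V K n
  | _, tru => tru
  | _, eq e e' => eq (e.subst θ) (e'.subst θ)
  | _, rel r args => rel r (fun i => (args i).subst θ)
  | _, neg φ => neg (φ.subst θ)
  | _, and φ ψ => and (φ.subst θ) (ψ.subst θ)
  | _, all φ => all (φ.subst θ)

/-- Satisfiability: symbols and free parameters may be chosen. -/
def Sat (φ : BoolExpr V K 0) : Prop :=
  ∃ (ρ : (a : V.Var) → V.Val (V.ty a)) (κ : K → ℕ), φ.Holds ρ κ Fin.elim0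

/-- Logical equivalence. -/
def Equiv (φ ψ : BoolExpr V K 0) : Prop :=
  ∀ (ρ : (a : V.Var) → V.Val (V.ty a)) (κ : K → ℕ),
    φ.Holds ρ κ Fin.elim0 ↔ ψ.Holds ρ κ Fin.elim0

end BoolExpr

namespace Mem

variable {V : Vocab} {K K' : Type}

def rename (f : K → K') (θ : Mem V K) : Mem V K' := fun a => (θ a).rename f

def value (ν : K → ℕ) (θ : Mem V K) : Mem V Empty := fun a => (θ a).value ν

/-- The composition `θ ∘ θ'`. -/
def comp (θ θ' : Mem V K) : Mem V K := fun a => (θ' a).subst θ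

def Equiv (θ θ' : Mem V K) : Prop := ∀ a, (θ a).Equiv (θ' a)

/-- The value in `θ` of an expression over program variables. -/
def exprIn {s : V.Srt} (θ : Mem V K) (e : SymExpr V Empty 0 s) : SymExpr V K 0 s :=
  (e.rename (fun k : Empty => k.elim)).subst θ

/-- The value in `θ` of a boolean expression over program variables. -/
def boolIn (θ : Mem V K) (γ : BoolExpr V Empty 0) : BoolExpr V K 0 :=
  (γ.rename (fun k : Empty => k.elim)).subst θ

open Classical in
noncomputable def set (θ : Mem V K) (x : V.Var) (e : SymExpr V K 0 (V.ty x)) : Mem V K :=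
  Function.update θ x e

open Classical in
/-- Effect of `x := y` for two variables of the same type. -/
noncomputable def copy (θ : Mem V K) (x y : V.Var) : Mem V K :=
  if h : V.ty y = V.ty x then θ.set x (h ▸ θ y) else θ

end Mem

/-! ### Programs -/

/-- Functions, their locations, their local variables (`owner a = some f`; global variables
have owner `none`), formal parameters and return variables `ret_f`. -/
structure Decls (V : Vocab) where
  Fn : Type
  Loc : Type
  fnOf : Loc → Fn
  owner : V.Var → Option Fn
  arity : Fn → ℕ
  formal : (f : Fn) → Fin (arity f) → V.Var
  ret : Fn → V.Var

/-- The actions (other than branching conditions). `call (some x) f args` is `x := f(args)` and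
`call none f args` is `f(args)`. `ret f e` is the statement `ret e` in the function `f`. -/
inductive Action {V : Vocab} (D : Decls V)
  | assign (x : V.Var) (e : SymExpr V Empty 0 (V.ty x)) : Action D
  | call (dest : Option V.Var) (f : D.Fn)
      (args : (i : Fin (D.arity f)) → SymExpr V Empty 0 (V.ty (D.formal f i))) : Action D
  | ret (f : D.Fn) (e : SymExpr V Empty 0 (V.ty (D.ret f))) : Action D
  | skip : Action D

/-- The out-edges of a location: none, a single edge labelled by an action, or two edges
labelled by `γ` and `¬ γ`. -/
inductive OutEdges {V : Vocab} (D : Decls V)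
  | none : OutEdges D
  | single (a : Action D) (target : D.Loc) : OutEdges D
  | branch (γ : BoolExpr V Empty 0) (target target' : D.Loc) : OutEdges D

/-- `l'` is the target of one of the given out-edges. -/
def OutEdges.HasTarget {V : Vocab} {D : Decls V} (o : OutEdges D) (l' : D.Loc) : Prop :=
  match o with
  | .none => False
  | .single _ l => l' = l
  | .branch _ l₁ l₂ => l' = l₁ ∨ l' = l₂

structure Program (V : Vocab) extends Decls V where
  start : Fn
  entry : Fn → Loc
  exit : Fn → Loc
  out : Loc → OutEdges toDecls
  fnOf_entry : ∀ f, fnOf (entry f) = f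
  fnOf_exit : ∀ f, fnOf (exit f) = f
  entry_ne_exit : ∀ f, entry f ≠ exit f
  /-- Edges connect locations of the same function. -/
  fnOf_target : ∀ l l', (out l).HasTarget l' → fnOf l' = fnOf l
  no_edge_to_entry : ∀ l f, ¬ (out l).HasTarget (entry f)
  no_edge_from_exit : ∀ f, out (exit f) = .none
  formal_injective : ∀ f, Function.Injective (formal f)
  owner_formal : ∀ f i, owner (formal f i) = some f
  ret_injective : Function.Injective ret
  owner_ret : ∀ f, owner (ret f) = none
  ret_ok : ∀ l f e l', out l = .single (.ret f e) l' → f = fnOf l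
  call_ok : ∀ l dest f args l', out l = .single (.call dest f args) l' →
    f ≠ start ∧ (∀ g, l ≠ entry g) ∧ (∀ g, l' ≠ exit g) ∧ ∀ x ∈ dest, V.ty x = V.ty (ret f)

section States

variable {V : Vocab}

namespace Program

def IsEntry (P : Program V) (l : P.Loc) : Prop := ∃ f, l = P.entry f

def IsExit (P : Program V) (l : P.Loc) : Prop := ∃ f, l = P.exit f

/-- A location with a single out-edge, which is a `skip` back to it. -/
def IsError (P : Program V) (l : P.Loc) : Prop := P.out l = .single .skip l

/-- The locations at which an execution ends. -/
def IsFinal (P : Program V) (l : P.Loc) : Prop := l = P.exit P.start ∨ P.IsError l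

end Program

/-! ### Templates (as tuples), call stacks and program states -/

/-- An ordinary call stack record: the local variables of the caller, the return location, and
the variable (if any) which the returned value is assigned to. -/
structure CallRec (P : Program V) (K : Type) where
  σ : (a : V.Var) → Option (SymExpr V K 0 (V.ty a))
  retLoc : P.Loc
  dest : Option V.Var

/-- An entry `(θᵢ, φᵢ, Ξᵢ, lᵢ)` of a template; its only parameter is `() : Unit`.
All call stacks are written with the top record first. -/
structure TemplateExit (P : Program V) where
  θ : Mem V Unit
  φ : BoolExpr V Unit 0
  Ξ : List (CallRec P Unit)
  l : P.Loc

/-- The tuples `(l, n, {(θ₁, φ₁, Ξ₁, l₁), …, (θₙ, φₙ, Ξₙ, lₙ)})`. -/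
structure GenTemplate (P : Program V) where
  l : P.Loc
  n : ℕ
  exits : Fin n → TemplateExit P

/-- The tuples `(l, n, {(θ₁, φ₁, Ξ₁, l₁), …, (θₙ, φₙ, Ξₙ, lₙ)}, θ, l')`. -/
structure RecTemplate (P : Program V) extends GenTemplate P where
  θ : Mem V Unit
  l' : P.Loc

/-- Call stack records: ordinary ones, the special ones `(t, κ)`, and `(⊥, ⊥)`, which stands
for any record. -/
inductive StackRec (P : Program V) (K : Type)
  | call (r : CallRec P K) : StackRec P K
  | special (t : RecTemplate P) (κ : K) : StackRec P K
  | any : StackRec P K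

/-- Program states `(θ, φ, Ξ, l)`; the top of the call stack is the head of the list `Ξ`. -/
structure State (P : Program V) (K : Type) where
  θ : Mem V K
  φ : BoolExpr V K 0
  Ξ : List (StackRec P K)
  l : P.Loc

variable {P : Program V} {K K' : Type}

namespace CallRec

def rename (f : K → K') (r : CallRec P K) : CallRec P K' :=
  ⟨fun a => (r.σ a).map (·.rename f), r.retLoc, r.dest⟩

def value (ν : K → ℕ) (r : CallRec P K) : CallRec P Empty :=
  ⟨fun a => (r.σ a).map (·.value ν), r.retLoc, r.dest⟩

def comp (θ : Mem V K) (r : CallRec P K) : CallRec P K :=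
  ⟨fun a => (r.σ a).map (·.subst θ), r.retLoc, r.dest⟩

/-- The records are defined for the same variables, with equivalent values, and agree in the
other components. -/
def Equiv (r r' : CallRec P K) : Prop :=
  (∀ a, Option.Rel SymExpr.Equiv (r.σ a) (r'.σ a)) ∧ r.retLoc = r'.retLoc ∧ r.dest = r'.dest

end CallRec

namespace StackRec

def rename (f : K → K') : StackRec P K → StackRec P K'
  | call r => call (r.rename f)
  | special t κ => special t (f κ)
  | any => any

/-- A record `(t, κ)` becomes `ν(κ)` records `(⊥, ⊥)`. -/
def value (ν : K → ℕ) : StackRec P K → List (StackRec P Empty)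
  | call r => [call (r.value ν)]
  | special _ κ => List.replicate (ν κ) any
  | any => [any]

def comp (θ : Mem V K) : StackRec P K → StackRec P K
  | call r => call (r.comp θ)
  | special t κ => special t κ
  | any => any

def Equiv : StackRec P K → StackRec P K → Prop
  | any, _ => True
  | _, any => True
  | call r, call r' => r.Equiv r'
  | special t κ, special t' κ' => t = t' ∧ κ = κ'
  | _, _ => False

end StackRec

namespace State

def rename (f : K → K') (s : State P K) : State P K' :=
  ⟨s.θ.rename f, s.φ.rename f, s.Ξ.map (·.rename f), s.l⟩

/-- `s⟨ν⟩` -/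
def value (ν : K → ℕ) (s : State P K) : State P Empty :=
  ⟨s.θ.value ν, s.φ.value ν, s.Ξ.flatMap (·.value ν), s.l⟩

/-- The composition `s ∘ s'` (the records of `s'` lie above those of `s`). -/
def comp (s s' : State P K) : State P K :=
  ⟨s.θ.comp s'.θ, s.φ.and (s'.φ.subst s.θ), s'.Ξ.map (·.comp s.θ) ++ s.Ξ, s'.l⟩

/-- `s ≡ s'` -/
def Equiv (s s' : State P K) : Prop :=
  s.θ.Equiv s'.θ ∧ s.φ.Equiv s'.φ ∧ List.Forall₂ StackRec.Equiv s.Ξ s'.Ξ ∧ s.l = s'.l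

/-- Equivalence on global variables. -/
def GlobalEquiv (s s' : State P K) : Prop :=
  (∀ a, P.owner a = none → (s.θ a).Equiv (s'.θ a)) ∧ s.φ.Equiv s'.φ ∧
    List.Forall₂ StackRec.Equiv s.Ξ s'.Ξ ∧ s.l = s'.l

/-- The initial state. -/
def init (P : Program V) (K : Type) : State P K :=
  ⟨Mem.init V K, .tru, [], P.entry P.start⟩

end State

/-- The state `(θᵢ, φᵢ, Ξᵢ, lᵢ)`. -/
def GenTemplate.exitState (t : GenTemplate P) (i : Fin t.n) : State P Unit :=
  ⟨(t.exits i).θ, (t.exits i).φ, (t.exits i).Ξ.map .call, (t.exits i).l⟩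

/-- The state `(θᵢ, φᵢ, [(t, κ)] ∘ Ξᵢ, lᵢ)`. -/
def RecTemplate.exitState (t : RecTemplate P) (i : Fin t.n) : State P Unit :=
  ⟨(t.exits i).θ, (t.exits i).φ, (t.exits i).Ξ.map .call ++ [.special t ()], (t.exits i).l⟩

/-! ### Classic symbolic execution steps -/

open Classical in
/-- The local variables of the function `f` as stored in a call stack record. -/
noncomputable def Mem.locals (P : Program V) (θ : Mem V K) (f : P.Fn) :
    (a : V.Var) → Option (SymExpr V K 0 (V.ty a)) :=
  fun a => if P.owner a = some f then some (θ a) else none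

open Classical in
/-- The memory at the entry of the function `f` called with the given arguments: global variables
are kept, formal parameters get the arguments, other local variables are undefined. -/
noncomputable def Mem.enter (P : Program V) (θ : Mem V K) (f : P.Fn)
    (args : (i : Fin (P.arity f)) → SymExpr V Empty 0 (V.ty (P.formal f i))) : Mem V K :=
  fun a =>
    if P.owner a = none then θ a
    else if h : ∃ i, P.formal f i = a then h.choose_spec ▸ θ.exprIn (args h.choose)
    else .sym a

open Classical in
/-- The memory after the return from the function `f` to the record `r`: global variables are
kept, the local variables of the caller are restored, all others are undefined, and the returned
value is assigned to its destination. -/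
noncomputable def Mem.leave (P : Program V) (θ : Mem V K) (f : P.Fn) (r : CallRec P K) :
    Mem V K :=
  let θ' : Mem V K := fun a => if P.owner a = none then θ a else (r.σ a).getD (.sym a)
  match r.dest with
  | none => θ'
  | some x => θ'.copy x (P.ret f)

/-- `ClassicStep P s s'`: `s'` is one of the classic successors of `s` (satisfiability of its path
condition is not tested yet). -/
inductive ClassicStep (P : Program V) (s : State P K) : State P K → Prop
  | assign (x : V.Var) (e : SymExpr V Empty 0 (V.ty x)) (l' : P.Loc)
      (h : P.out s.l = .single (.assign x e) l') :
      ClassicStep P s ⟨s.θ.set x (s.θ.exprIn e), s.φ, s.Ξ, l'⟩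
  | skip (l' : P.Loc) (h : P.out s.l = .single .skip l') :
      ClassicStep P s ⟨s.θ, s.φ, s.Ξ, l'⟩
  | ret (f : P.Fn) (e : SymExpr V Empty 0 (V.ty (P.ret f))) (l' : P.Loc)
      (h : P.out s.l = .single (.ret f e) l') :
      ClassicStep P s ⟨s.θ.set (P.ret f) (s.θ.exprIn e), s.φ, s.Ξ, l'⟩
  | call (dest : Option V.Var) (f : P.Fn)
      (args : (i : Fin (P.arity f)) → SymExpr V Empty 0 (V.ty (P.formal f i))) (l' : P.Loc)
      (h : P.out s.l = .single (.call dest f args) l') :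
      ClassicStep P s ⟨s.θ.enter P f args, s.φ,
        .call ⟨s.θ.locals P (P.fnOf s.l), l', dest⟩ :: s.Ξ, P.entry f⟩
  | branchTrue (γ : BoolExpr V Empty 0) (l₁ l₂ : P.Loc) (h : P.out s.l = .branch γ l₁ l₂) :
      ClassicStep P s ⟨s.θ, s.φ.and (s.θ.boolIn γ), s.Ξ, l₁⟩
  | branchFalse (γ : BoolExpr V Empty 0) (l₁ l₂ : P.Loc) (h : P.out s.l = .branch γ l₁ l₂) :
      ClassicStep P s ⟨s.θ, s.φ.and (s.θ.boolIn γ.neg), s.Ξ, l₂⟩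
  | leave (f : P.Fn) (r : CallRec P K) (Ξ : List (StackRec P K)) (hl : s.l = P.exit f)
      (hΞ : s.Ξ = .call r :: Ξ) :
      ClassicStep P s ⟨s.θ.leave P f r, s.φ, Ξ, r.retLoc⟩

end States

/-! ### Symbolic execution trees -/

/-- A (possibly infinite) tree with vertices labelled in `S`, given by the label of the root and
the set of labels of the children of a vertex; the latter may depend on the label of the vertex
and on the labels of its proper ancestors (nearest first). -/
structure ExecTree (S : Type) where
  root : S
  children : S → List S → Set S

namespace ExecTree

variable {S : Type}

/-- Vertices are identified with the paths to them. -/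
inductive IsVertex (T : ExecTree S) : S → List S → Prop
  | root : IsVertex T T.root []
  | child {s s' : S} {anc : List S} (h : IsVertex T s anc) (h' : s' ∈ T.children s anc) :
      IsVertex T s' (s :: anc)

structure Vertex (T : ExecTree S) where
  s : S
  anc : List S
  isVertex : T.IsVertex s anc

variable {T : ExecTree S}

def Vertex.IsLeaf (u : T.Vertex) : Prop := T.children u.s u.anc = ∅

/-- `u ≤ v`: the vertex `u` lies on the path from the root to `v`. -/
instance : LE T.Vertex := ⟨fun u v => (u.s :: u.anc) <:+ (v.s :: v.anc)⟩

/-- `u < v`: `v` is a (not necessarily direct) successor of `u`. -/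
instance : LT T.Vertex := ⟨fun u v => u ≤ v ∧ u ≠ v⟩

end ExecTree

section Trees

variable {V : Vocab}

/-- The classic symbolic execution tree. -/
def classicTree (P : Program V) : ExecTree (State P Empty) where
  root := State.init P Empty
  children s _ := {s' | ¬ P.IsFinal s.l ∧ ClassicStep P s s' ∧ s'.φ.Sat}

variable {P : Program V}

/-- On the path from `u` to `w`, execution does not return from the function activation
in which `u` lies. -/
def Inside (u w : (classicTree P).Vertex) : Prop :=
  ∀ v : (classicTree P).Vertex, u ≤ v → v ≤ w → u.s.Ξ.length ≤ v.s.Ξ.length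

/-- The requirements common to both kinds of templates. -/
def GenTemplate.Basic (t : GenTemplate P) : Prop :=
  0 < t.n ∧ (∀ i, (t.exits i).φ.Sat) ∧
    (∀ i j, i ≠ j → ((t.exits i).φ.and (t.exits j).φ).Equiv (.neg .tru)) ∧
    ∀ i, ¬ P.IsEntry (t.exits i).l ∧ ¬ P.IsExit (t.exits i).l

/-- Templates with one parameter. -/
structure GenTemplate.IsTemplate (t : GenTemplate P) : Prop where
  basic : t.Basic
  l_not_entry : ¬ P.IsEntry t.l
  l_not_exit : ¬ P.IsExit t.l
  complete : ∀ u e : (classicTree P).Vertex, u.s.l = t.l → u ≤ e → e.IsLeaf →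
    ∃ w : (classicTree P).Vertex, u < w ∧ w ≤ e ∧ Inside u w ∧
      ∃ (i : Fin t.n) (ν : ℕ), w.s.Equiv (u.s.comp ((t.exitState i).value fun _ => ν))
  sound : ∀ (u : (classicTree P).Vertex) (i : Fin t.n) (ν : ℕ), u.s.l = t.l →
    (u.s.φ.and (((t.exits i).φ.value fun _ => ν).subst u.s.θ)).Sat →
    ∃ w : (classicTree P).Vertex, u < w ∧
      w.s.Equiv (u.s.comp ((t.exitState i).value fun _ => ν))

/-- The activation directly above the special record of a recursion template with exit
`x` is an activation of the function `f`: the bottom record of the call stack of `x` returns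
into `f`, or that stack is empty and the location of `x` lies in `f`. -/
def TemplateExit.LiesIn (x : TemplateExit P) (f : P.Fn) : Prop :=
  P.fnOf ((x.Ξ.getLast?.map CallRec.retLoc).getD x.l) = f

/-- `w'` is at the location `l'` and the call stack of `w` has there been reduced by its
topmost `m` records. -/
def ReturnsTo (w w' : (classicTree P).Vertex) (m : ℕ) (l' : P.Loc) : Prop :=
  w'.s.l = l' ∧ w'.s.Ξ = w.s.Ξ.drop m

/-- Recursion templates with one parameter. -/
structure RecTemplate.IsTemplate (t : RecTemplate P) : Prop where
  basic : t.Basic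
  function : ∃ f : P.Fn, t.l = P.entry f ∧ t.l' = P.exit f ∧ (∀ i, (t.exits i).LiesIn f) ∧
    ∃ l dest args target, P.out l = .single (.call dest f args) target
  complete : ∀ u e : (classicTree P).Vertex, u.s.l = t.l → u ≤ e → e.IsLeaf →
    ∃ w : (classicTree P).Vertex, u < w ∧ w ≤ e ∧ ¬ w.IsLeaf ∧ Inside u w ∧
      ∃ (i : Fin t.n) (ν : ℕ), w.s.Equiv (u.s.comp ((t.exitState i).value fun _ => ν)) ∧
        ∀ w' : (classicTree P).Vertex, w < w' → w' ≤ e →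
          ReturnsTo w w' (t.exits i).Ξ.length t.l' →
          (∀ v : (classicTree P).Vertex, w < v → v < w' →
            ¬ ReturnsTo w v (t.exits i).Ξ.length t.l') →
          ∃ u' : (classicTree P).Vertex, w' ≤ u' ∧ u' ≤ e ∧ ¬ u'.IsLeaf ∧ Inside u u' ∧
            u'.s.GlobalEquiv ⟨w'.s.θ.comp (t.θ.value fun _ => ν), w'.s.φ, u.s.Ξ, t.l'⟩
  sound : ∀ (u : (classicTree P).Vertex) (i : Fin t.n) (ν : ℕ), u.s.l = t.l →
    (u.s.φ.and (((t.exits i).φ.value fun _ => ν).subst u.s.θ)).Sat →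
    ∃ w : (classicTree P).Vertex, u < w ∧
      w.s.Equiv (u.s.comp ((t.exitState i).value fun _ => ν))

/-- Tuples of both kinds. -/
inductive Template (P : Program V)
  | general (t : GenTemplate P) : Template P
  | recursion (t : RecTemplate P) : Template P

namespace Template

/-- The entry location of a template. -/
def l : Template P → P.Loc
  | general t => t.l
  | recursion t => t.l

def IsTemplate : Template P → Prop
  | general t => t.IsTemplate
  | recursion t => t.IsTemplate

end Template

/-! ### Compact symbolic execution -/

/-- The compact execution is about to return from the recursion folded in the topmost record. -/
def Unwinds (s : State P ℕ) : Prop := ∃ t κ Ξ, s.Ξ = .special t κ :: Ξ ∧ s.l = t.l'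

/-- A template of the set `p` has to be instantiated at the state `s`. -/
def Instantiates (p : Set (Template P)) (s : State P ℕ) : Prop :=
  ¬ P.IsFinal s.l ∧ ¬ Unwinds s ∧ ∃ t ∈ p, t.l = s.l

/-- The successors of a non-final state `s` in the compact execution with the templates `p`, where
`c` is the template chosen at `s` and `κ` is the fresh parameter. -/
inductive CompactStep (p : Set (Template P)) (s : State P ℕ) (c : Template P) (κ : ℕ) :
    State P ℕ → Prop
  | unwind (t : RecTemplate P) (κ' : ℕ) (Ξ : List (StackRec P ℕ))
      (hΞ : s.Ξ = .special t κ' :: Ξ) (hl : s.l = t.l') :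
      CompactStep p s c κ ⟨s.θ.comp (t.θ.rename fun _ => κ'), s.φ, Ξ, t.l'⟩
  | recursion (h : Instantiates p s) (t : RecTemplate P) (hc : c = .recursion t) (i : Fin t.n) :
      CompactStep p s c κ (s.comp ((t.exitState i).rename fun _ => κ))
  | general (h : Instantiates p s) (t : GenTemplate P) (hc : c = .general t) (i : Fin t.n) :
      CompactStep p s c κ (s.comp ((t.exitState i).rename fun _ => κ))
  | classic (hu : ¬ Unwinds s) (hi : ¬ Instantiates p s) (s' : State P ℕ)
      (h : ClassicStep P s s') : CompactStep p s c κ s'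

/-- The compact symbolic execution tree built with the set `p` of templates. At the vertex with
label `s` and ancestors labelled by `anc`, the template `choose s anc` and the parameter
`fresh s anc` are used (if a template is instantiated there). -/
def compactTree (p : Set (Template P)) (choose : State P ℕ → List (State P ℕ) → Template P)
    (fresh : State P ℕ → List (State P ℕ) → ℕ) : ExecTree (State P ℕ) where
  root := State.init P ℕ
  children s anc :=
    {s' | ¬ P.IsFinal s.l ∧ CompactStep p s (choose s anc) (fresh s anc) s' ∧ s'.φ.Sat}

end Trees

end CSE

/-!
The path of the classic tree to the leaf `e` is followed by vertices of the compact tree: each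
represented vertex `u < e` is succeeded by another one further down the path. Outside templates one
classic step is matched by one compact step; at the entry of a template, completeness gives a vertex
of the path which is an instance of one of the exits, for some value `n` of the parameter. As the
parameter is fresh, representing `u` for all values of the parameters still to be introduced leaves
`n` free to be chosen.

The delicate point is a special record `(t, κ)`. It stands for the records of `κ` folded
activations, and the part of the completeness of `t` which speaks about the return from them only
becomes relevant when the compact execution reaches `t.l'` below this record. It is carried along
as a property of the record, and it survives the steps in between because none of them pops a
folded activation.
-/

namespace CSE

/-! ### Values of expressions, memories and call records -/

section Semantics

variable {V : Vocab} {K K' : Type}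

attribute [instance] Vocab.val_nonempty

/-- Assignments of values to the symbols `Θ(a)`; equally, concrete memories. -/
abbrev Assignment (V : Vocab) : Type := (a : V.Var) → V.Val (V.ty a)

/-- The concrete memory denoted by a symbolic memory when the symbols are read in `ρ` and the
parameters in `κ`. -/
def Mem.den (θ : Mem V K) (ρ : Assignment V) (κ : K → ℕ) : Assignment V :=
  fun a => (θ a).eval ρ κ Fin.elim0

namespace SymExpr

variable {n : ℕ} {s s' : V.Srt}

theorem eval_value (ν : K → ℕ) (ρ : Assignment V) (κ : Empty → ℕ) (b : Fin n → ℕ)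
    (e : SymExpr V K n s) : (e.value ν).eval ρ κ b = e.eval ρ ν b := by
  induction e with
  | op o args ih => simp only [value, eval, ih]
  | _ => simp only [value, eval]

theorem eval_rename (f : K → K') (ρ : Assignment V) (κ : K' → ℕ) (b : Fin n → ℕ)
    (e : SymExpr V K n s) : (e.rename f).eval ρ κ b = e.eval ρ (fun k => κ (f k)) b := by
  induction e with
  | op o args ih => simp only [rename, eval, ih]
  | _ => simp only [rename, eval]

theorem eval_lift (ρ : Assignment V) (κ : K → ℕ) (b : Fin n → ℕ) (e : SymExpr V K 0 s) :
    (e.lift n).eval ρ κ b = e.eval ρ κ Fin.elim0 := by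
  induction e with
  | op o args ih => simp only [lift, eval, ih]
  | bound i => exact i.elim0
  | _ => simp only [lift, eval]

theorem eval_subst (θ : Mem V K) (ρ : Assignment V) (κ : K → ℕ) (b : Fin n → ℕ)
    (e : SymExpr V K n s) : (e.subst θ).eval ρ κ b = e.eval (θ.den ρ κ) κ b := by
  induction e with
  | op o args ih => simp only [subst, eval, ih]
  | sym a => simp only [subst, eval, eval_lift, Mem.den]
  | _ => simp only [subst, eval]

theorem eval_cast (h : s = s') (e : SymExpr V K n s) (ρ : Assignment V) (κ : K → ℕ)
    (b : Fin n → ℕ) : (h ▸ e : SymExpr V K n s').eval ρ κ b = (h ▸ e.eval ρ κ b : V.Val s') := by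
  subst h
  rfl

end SymExpr

namespace BoolExpr

variable {n : ℕ}

theorem holds_value (ν : K → ℕ) (ρ : Assignment V) (κ : Empty → ℕ) (b : Fin n → ℕ)
    (φ : BoolExpr V K n) : (φ.value ν).Holds ρ κ b ↔ φ.Holds ρ ν b := by
  induction φ with
  | tru => simp only [value, Holds]
  | eq e e' => simp only [value, Holds, SymExpr.eval_value]
  | rel r args => simp only [value, Holds, SymExpr.eval_value]
  | neg φ ih => simp only [value, Holds, ih]
  | and φ ψ ih ih' => simp only [value, Holds, ih, ih']
  | all φ ih => simp only [value, Holds, ih]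

theorem holds_rename (f : K → K') (ρ : Assignment V) (κ : K' → ℕ) (b : Fin n → ℕ)
    (φ : BoolExpr V K n) : (φ.rename f).Holds ρ κ b ↔ φ.Holds ρ (fun k => κ (f k)) b := by
  induction φ with
  | tru => simp only [rename, Holds]
  | eq e e' => simp only [rename, Holds, SymExpr.eval_rename]
  | rel r args => simp only [rename, Holds, SymExpr.eval_rename]
  | neg φ ih => simp only [rename, Holds, ih]
  | and φ ψ ih ih' => simp only [rename, Holds, ih, ih']
  | all φ ih => simp only [rename, Holds, ih]

theorem holds_subst (θ : Mem V K) (ρ : Assignment V) (κ : K → ℕ) (b : Fin n → ℕ)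
    (φ : BoolExpr V K n) : (φ.subst θ).Holds ρ κ b ↔ φ.Holds (θ.den ρ κ) κ b := by
  induction φ with
  | tru => simp only [subst, Holds]
  | eq e e' => simp only [subst, Holds, SymExpr.eval_subst]
  | rel r args => simp only [subst, Holds, SymExpr.eval_subst]
  | neg φ ih => simp only [subst, Holds, ih]
  | and φ ψ ih ih' => simp only [subst, Holds, ih, ih']
  | all φ ih => simp only [subst, Holds, ih]

end BoolExpr

namespace Mem

theorem den_comp (θ θ' : Mem V K) (ρ : Assignment V) (κ : K → ℕ) :
    (θ.comp θ').den ρ κ = θ'.den (θ.den ρ κ) κ :=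
  funext fun _ => SymExpr.eval_subst ..

theorem den_value (ν : K → ℕ) (θ : Mem V K) (ρ : Assignment V) (κ : Empty → ℕ) :
    (θ.value ν).den ρ κ = θ.den ρ ν :=
  funext fun _ => SymExpr.eval_value ..

theorem den_rename (f : K → K') (θ : Mem V K) (ρ : Assignment V) (κ : K' → ℕ) :
    (θ.rename f).den ρ κ = θ.den ρ (fun k => κ (f k)) :=
  funext fun _ => SymExpr.eval_rename ..

theorem eval_exprIn (θ : Mem V K) {s : V.Srt} (e : SymExpr V Empty 0 s) (ρ : Assignment V)
    (κ : K → ℕ) : (θ.exprIn e).eval ρ κ Fin.elim0 = e.eval (θ.den ρ κ) Empty.elim Fin.elim0 := by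
  rw [exprIn, SymExpr.eval_subst, SymExpr.eval_rename,
    Subsingleton.elim (fun k : Empty => κ k.elim) Empty.elim]

theorem holds_boolIn (θ : Mem V K) (γ : BoolExpr V Empty 0) (ρ : Assignment V) (κ : K → ℕ) :
    (θ.boolIn γ).Holds ρ κ Fin.elim0 ↔ γ.Holds (θ.den ρ κ) Empty.elim Fin.elim0 := by
  rw [boolIn, BoolExpr.holds_subst, BoolExpr.holds_rename,
    Subsingleton.elim (fun k : Empty => κ k.elim) Empty.elim]

open Classical in
theorem den_set (θ : Mem V K) (x : V.Var) (e : SymExpr V K 0 (V.ty x)) (ρ : Assignment V)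
    (κ : K → ℕ) :
    (θ.set x e).den ρ κ = Function.update (θ.den ρ κ) x (e.eval ρ κ Fin.elim0) := by
  funext a
  obtain rfl | h := eq_or_ne a x
  · simp [den, set]
  · simp [den, set, h]

end Mem

/-- The condition `φ`, with its parameters read in `κ`, holds for the same concrete memories as `ψ`
with its parameters read in `κ'`. -/
def BoolExpr.Agrees (φ : BoolExpr V K 0) (κ : K → ℕ) (ψ : BoolExpr V K' 0) (κ' : K' → ℕ) : Prop :=
  ∀ ρ : Assignment V, φ.Holds ρ κ Fin.elim0 ↔ ψ.Holds ρ κ' Fin.elim0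

/-- The memory `θ`, with its parameters read in `κ`, denotes the same concrete memories as `θ'`
with its parameters read in `κ'`. -/
def Mem.Agrees (θ : Mem V K) (κ : K → ℕ) (θ' : Mem V K') (κ' : K' → ℕ) : Prop :=
  ∀ ρ : Assignment V, θ.den ρ κ = θ'.den ρ κ'

namespace BoolExpr.Agrees

variable {φ : BoolExpr V K 0} {ψ : BoolExpr V K' 0} {κ : K → ℕ} {κ' : K' → ℕ}

theorem and_boolIn (h : φ.Agrees κ ψ κ') {θ : Mem V K} {θ' : Mem V K'} (hθ : θ.Agrees κ θ' κ')
    (γ : BoolExpr V Empty 0) : (φ.and (θ.boolIn γ)).Agrees κ (ψ.and (θ'.boolIn γ)) κ' := by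
  intro ρ
  simp only [Holds, Mem.holds_boolIn, h ρ, hθ ρ]

theorem sat {φ : BoolExpr V Empty 0} {κ : Empty → ℕ} (h : φ.Agrees κ ψ κ') (hφ : φ.Sat) :
    ψ.Sat := by
  obtain ⟨ρ, κ₀, hρ⟩ := hφ
  rw [Subsingleton.elim κ₀ κ] at hρ
  exact ⟨ρ, κ', (h ρ).1 hρ⟩

theorem equiv_value {φ : BoolExpr V Empty 0} {κ : Empty → ℕ} (h : φ.Agrees κ ψ κ') :
    φ.Equiv (ψ.value κ') := by
  intro ρ κ₀
  rw [Subsingleton.elim κ₀ κ, h ρ, holds_value]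

end BoolExpr.Agrees

variable {P : Program V}

namespace CallRec

/-- The concrete values stored in a call record. -/
def den (r : CallRec P K) (ρ : Assignment V) (κ : K → ℕ) (a : V.Var) : Option (V.Val (V.ty a)) :=
  (r.σ a).map fun e => e.eval ρ κ Fin.elim0

theorem den_comp (θ : Mem V K) (r : CallRec P K) (ρ : Assignment V) (κ : K → ℕ) :
    (r.comp θ).den ρ κ = r.den (θ.den ρ κ) κ :=
  funext fun a => by
    simp only [den, comp, Option.map_map, Function.comp_def, SymExpr.eval_subst]

theorem den_value (ν : K → ℕ) (r : CallRec P K) (ρ : Assignment V) (κ : Empty → ℕ) :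
    (r.value ν).den ρ κ = r.den ρ ν :=
  funext fun a => by
    simp only [den, value, Option.map_map, Function.comp_def, SymExpr.eval_value]

theorem den_rename (f : K → K') (r : CallRec P K) (ρ : Assignment V) (κ : K' → ℕ) :
    (r.rename f).den ρ κ = r.den ρ fun k => κ (f k) :=
  funext fun a => by
    simp only [den, rename, Option.map_map, Function.comp_def, SymExpr.eval_rename]

theorem equiv_iff {r r' : CallRec P K} :
    r.Equiv r' ↔ (∀ ρ κ, r.den ρ κ = r'.den ρ κ) ∧ r.retLoc = r'.retLoc ∧ r.dest = r'.dest := by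
  refine and_congr_left fun _ => ⟨fun h ρ κ => funext fun a => ?_, fun h a => ?_⟩
  · rw [den, den]
    have hrel := h a
    generalize r.σ a = x, r'.σ a = y at hrel
    cases hrel with
    | some h => exact congrArg some (h ρ κ)
    | none => rfl
  · simp only [funext_iff, den] at h
    replace h := fun ρ κ => h ρ κ a
    generalize r.σ a = x, r'.σ a = y at h
    have isSome_eq := congrArg Option.isSome (h (Classical.arbitrary _) 0)
    cases x <;> cases y
    · exact .none
    · simp at isSome_eq
    · simp at isSome_eq
    · exact .some fun ρ κ => Option.some.inj (h ρ κ)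

/-- The record `r`, with its parameters read in `κ`, stores the same concrete values as `r'` with
its parameters read in `κ'`, and leads back to the same place. -/
structure Agrees (r : CallRec P K) (κ : K → ℕ) (r' : CallRec P K') (κ' : K' → ℕ) : Prop where
  den : ∀ ρ : Assignment V, r.den ρ κ = r'.den ρ κ'
  retLoc : r.retLoc = r'.retLoc
  dest : r.dest = r'.dest

theorem Agrees.equiv_value {r : CallRec P Empty} {κ : Empty → ℕ} {r' : CallRec P K'} {κ' : K' → ℕ}
    (h : r.Agrees κ r' κ') : r.Equiv (r'.value κ') :=
  equiv_iff.2 ⟨fun ρ κ₀ => by rw [Subsingleton.elim κ₀ κ, h.den, den_value], h.retLoc, h.dest⟩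

end CallRec

namespace Mem.Agrees

variable {θ : Mem V K} {κ : K → ℕ} {θ' : Mem V K'} {κ' : K' → ℕ}

theorem set_exprIn (h : θ.Agrees κ θ' κ') (x : V.Var) (e : SymExpr V Empty 0 (V.ty x)) :
    (θ.set x (θ.exprIn e)).Agrees κ (θ'.set x (θ'.exprIn e)) κ' := by
  intro ρ
  simp only [den_set, eval_exprIn, h ρ]

theorem enter (h : θ.Agrees κ θ' κ') (f : P.Fn)
    (args : (i : Fin (P.arity f)) → SymExpr V Empty 0 (V.ty (P.formal f i))) :
    (θ.enter P f args).Agrees κ (θ'.enter P f args) κ' := by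
  intro ρ
  funext a
  simp only [den, Mem.enter]
  split_ifs with global formal
  · exact congrFun (h ρ) a
  · generalize_proofs formal_eq
    generalize formal.choose = i at formal_eq
    subst formal_eq
    simp only [eval_exprIn, h ρ]
  · rfl

theorem copy (h : θ.Agrees κ θ' κ') (x y : V.Var) : (θ.copy x y).Agrees κ (θ'.copy x y) κ' := by
  intro ρ
  simp only [Mem.copy]
  split_ifs with ty_eq
  · simp only [den_set, SymExpr.eval_cast]
    rw [h ρ, show (θ y).eval ρ κ _ = _ from congrFun (h ρ) y]
    rfl
  · exact h ρ

theorem locals (h : θ.Agrees κ θ' κ') (f : P.Fn) (l : P.Loc) (dest : Option V.Var) :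
    CallRec.Agrees (P := P) ⟨θ.locals P f, l, dest⟩ κ ⟨θ'.locals P f, l, dest⟩ κ' where
  den ρ := by
    funext a
    simp only [CallRec.den, Mem.locals]
    split_ifs
    · exact congrArg some (congrFun (h ρ) a)
    · rfl
  retLoc := rfl
  dest := rfl

theorem leave (h : ∀ ρ : Assignment V, ∀ a, P.owner a = none → θ.den ρ κ a = θ'.den ρ κ' a)
    (f : P.Fn) {r : CallRec P K} {r' : CallRec P K'} (hr : r.Agrees κ r' κ') :
    (θ.leave P f r).Agrees κ (θ'.leave P f r') κ' := by
  classical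
  have eval_getD {K : Type} (r : CallRec P K) (ρ : Assignment V) (κ : K → ℕ) (a : V.Var) :
      ((r.σ a).getD (.sym a)).eval ρ κ Fin.elim0 = (r.den ρ κ a).getD (ρ a) := by
    rw [CallRec.den]
    cases r.σ a <;> rfl
  have restored : Mem.Agrees
      (fun a => if P.owner a = none then θ a else (r.σ a).getD (.sym a)) κ
      (fun a => if P.owner a = none then θ' a else (r'.σ a).getD (.sym a)) κ' := by
    intro ρ
    funext a
    simp only [den]
    split_ifs with global
    · exact h ρ a global
    · rw [eval_getD, eval_getD, hr.den]
  simp only [Mem.leave, hr.dest]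
  cases r'.dest with
  | none => exact restored
  | some x => exact restored.copy x (P.ret f)

theorem equiv_value {θ : Mem V Empty} {κ : Empty → ℕ} (h : θ.Agrees κ θ' κ') :
    θ.Equiv (θ'.value κ') := by
  intro a ρ κ₀
  rw [Subsingleton.elim κ₀ κ]
  exact (congrFun (h ρ) a).trans (SymExpr.eval_value ..).symm

end Mem.Agrees

section Instances

variable {θ : Mem V Empty} {κ : Empty → ℕ} {θ' : Mem V K} {κ' : K → ℕ} {k : K}

theorem Mem.Agrees.of_equiv_comp (h : θ.Agrees κ θ' κ') {θ₁ : Mem V Empty} {η : Mem V Unit}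
    (hθ₁ : θ₁.Equiv (θ.comp (η.value fun _ => κ' k))) :
    θ₁.Agrees κ (θ'.comp (η.rename fun _ => k)) κ' := by
  intro ρ
  calc θ₁.den ρ κ = (θ.comp (η.value fun _ => κ' k)).den ρ κ := funext fun a => hθ₁ a ρ κ
    _ = (θ'.comp (η.rename fun _ => k)).den ρ κ' := by
      rw [den_comp, den_value, den_comp, den_rename, h ρ]

theorem BoolExpr.Agrees.of_equiv_and_subst {φ : BoolExpr V Empty 0} {φ' : BoolExpr V K 0}
    (hφ : φ.Agrees κ φ' κ') (h : θ.Agrees κ θ' κ') {φ₁ : BoolExpr V Empty 0}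
    {ψ : BoolExpr V Unit 0} (hφ₁ : φ₁.Equiv (φ.and ((ψ.value fun _ => κ' k).subst θ))) :
    φ₁.Agrees κ (φ'.and ((ψ.rename fun _ => k).subst θ')) κ' := by
  intro ρ
  simp only [hφ₁ ρ κ, Holds, holds_subst, holds_value, holds_rename, hφ ρ, h ρ]

theorem CallRec.Agrees.of_equiv_comp (h : θ.Agrees κ θ' κ') {r : CallRec P Empty}
    {x : CallRec P Unit} (hr : r.Equiv ((x.value fun _ => κ' k).comp θ)) :
    r.Agrees κ ((x.rename fun _ => k).comp θ') κ' := by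
  obtain ⟨hden, hloc, hdest⟩ := equiv_iff.1 hr
  exact ⟨fun ρ => by rw [hden, den_comp, den_value, den_comp, den_rename, h ρ], hloc, hdest⟩

end Instances

end Semantics

/-! ### The tree order -/

namespace ExecTree.Vertex

variable {S : Type} {T : ExecTree S} {u v w : T.Vertex}

/-- The labels on the path from the vertex `u` back to the root; `u ≤ v` says that the path of `u`
is a suffix of that of `v`. -/
def path (u : T.Vertex) : List S := u.s :: u.anc

theorem path_injective : Function.Injective (path (T := T)) := by
  rintro ⟨s, anc, hu⟩ ⟨s', anc', hv⟩ h
  cases h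
  rfl

instance : PartialOrder T.Vertex where
  le_refl u := List.suffix_refl u.path
  le_trans _ _ _ := List.IsSuffix.trans
  le_antisymm _ _ h h' := path_injective (h.eq_of_length_le h'.length_le)
  lt_iff_le_not_ge _ _ := and_congr_right fun h =>
    not_congr ⟨fun h' => h' ▸ h, fun h' => path_injective (h.eq_of_length_le h'.length_le)⟩

theorem le_total_of_le (hu : u ≤ w) (hv : v ≤ w) : u ≤ v ∨ v ≤ u :=
  List.suffix_or_suffix_of_suffix hu hv

theorem finite_Iic (w : T.Vertex) : (Set.Iic w).Finite :=
  .of_finite_image ((List.finite_toSet w.path.tails).subset <|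
    Set.image_subset_iff.2 fun _ hu => (List.mem_tails _ _).2 hu) path_injective.injOn

noncomputable instance : LocallyFiniteOrder T.Vertex :=
  .ofFiniteIcc fun _ v => v.finite_Iic.subset Set.Icc_subset_Iic_self

instance : OrderBot T.Vertex where
  bot := ⟨T.root, [], .root⟩
  bot_le := by
    rintro ⟨s, anc, h⟩
    induction h with
    | root => exact List.suffix_refl _
    | child _ _ ih => exact ih.trans (List.suffix_cons _ _)

/-- The child of `u` labelled by `s`. -/
def child (u : T.Vertex) (s : S) (h : s ∈ T.children u.s u.anc) : T.Vertex :=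
  ⟨s, u.path, u.isVertex.child h⟩

theorem covBy_child {s : S} (h : s ∈ T.children u.s u.anc) : u ⋖ u.child s h := by
  refine ⟨⟨List.suffix_cons _ _, fun hu => ?_⟩, fun v huv hv => ?_⟩
  · exact absurd (congrArg (fun v => v.anc.length) hu) (Nat.lt_succ_self _).ne
  · rcases List.suffix_cons_iff.1 hv.le with h' | h'
    · exact hv.ne (path_injective h')
    · exact huv.not_ge h'

theorem exists_child_eq_of_covBy (h : u ⋖ v) :
    ∃ (s : S) (hs : s ∈ T.children u.s u.anc), v = u.child s hs := by
  obtain ⟨s, anc, hv⟩ := v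
  cases hv with
  | root => exact absurd (h.lt.trans_le bot_le) (lt_irrefl _)
  | @child s' _ anc hs' hs =>
    let parent : T.Vertex := ⟨s', anc, hs'⟩
    have parent_covBy : parent ⋖ parent.child s hs := covBy_child hs
    rcases le_total_of_le h.le parent_covBy.le with hu | hu
    · obtain rfl | hu := hu.eq_or_lt
      · exact ⟨s, hs, rfl⟩
      · exact absurd parent_covBy.lt (h.2 hu)
    · obtain rfl | hu := hu.eq_or_lt
      · exact ⟨s, hs, rfl⟩
      · exact absurd h.lt (parent_covBy.2 hu)

theorem label_mem_children (h : u ⋖ v) : v.s ∈ T.children u.s u.anc := by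
  obtain ⟨s, hs, rfl⟩ := exists_child_eq_of_covBy h
  exact hs

end ExecTree.Vertex

open ExecTree

/-! ### Stacks along the paths of the classic tree -/

section ClassicTree

variable {V : Vocab} {P : Program V} {K K' : Type}

namespace Program

theorem exit_injective (P : Program V) : Function.Injective P.exit :=
  Function.LeftInverse.injective P.fnOf_exit

theorem entry_injective (P : Program V) : Function.Injective P.entry :=
  Function.LeftInverse.injective P.fnOf_entry

theorem not_isEntry_of_hasTarget {l l' : P.Loc} (h : (P.out l).HasTarget l') : ¬ P.IsEntry l' := by
  rintro ⟨f, rfl⟩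
  exact P.no_edge_to_entry _ _ h

theorem not_isEntry_exit (P : Program V) (f : P.Fn) : ¬ P.IsEntry (P.exit f) := by
  rintro ⟨g, hg⟩
  obtain rfl : f = g := by simpa only [P.fnOf_entry, P.fnOf_exit] using congrArg P.fnOf hg
  exact P.entry_ne_exit _ hg.symm

end Program

namespace ClassicStep

variable {s s' : State P K}

theorem stack_cases (h : ClassicStep P s s') :
    ((P.out s.l).HasTarget s'.l ∧ s'.Ξ = s.Ξ) ∨
      (∃ r, (P.out s.l).HasTarget r.retLoc ∧ s'.Ξ = .call r :: s.Ξ) ∨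
      ∃ r, s.Ξ = .call r :: s'.Ξ ∧ s'.l = r.retLoc := by
  cases h with
  | assign x e l' h => exact .inl ⟨by rw [h]; rfl, rfl⟩
  | skip l' h => exact .inl ⟨by rw [h]; rfl, rfl⟩
  | ret f e l' h => exact .inl ⟨by rw [h]; rfl, rfl⟩
  | branchTrue γ l₁ l₂ h => exact .inl ⟨by rw [h]; exact .inl rfl, rfl⟩
  | branchFalse γ l₁ l₂ h => exact .inl ⟨by rw [h]; exact .inr rfl, rfl⟩
  | call dest f args l' h => exact .inr (.inl ⟨_, by rw [h]; rfl, rfl⟩)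
  | leave f r Ξ hl hΞ => exact .inr (.inr ⟨r, hΞ, rfl⟩)

theorem eq_leave (h : ClassicStep P s s') {f : P.Fn} (hf : s.l = P.exit f) :
    ∃ r Ξ, s.Ξ = .call r :: Ξ ∧ s' = ⟨s.θ.leave P f r, s.φ, Ξ, r.retLoc⟩ := by
  have hout := P.no_edge_from_exit f
  cases h with
  | leave g r Ξ hl hΞ =>
    obtain rfl := P.exit_injective (hl.symm.trans hf)
    exact ⟨r, Ξ, hΞ, rfl⟩
  | _ => simp_all

end ClassicStep

/-- The location, in the activation at the bottom of the records `B`, at which the execution is, or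
at which it will continue once the control is back in this activation. -/
def baseLoc (B : List (CallRec P K)) (l : P.Loc) : P.Loc :=
  (B.getLast?.map CallRec.retLoc).getD l

theorem baseLoc_cons (r : CallRec P K) (B : List (CallRec P K)) (l : P.Loc) :
    baseLoc (r :: B) l = baseLoc B r.retLoc := by
  cases B with
  | nil => rfl
  | cons r' B => simp [baseLoc, List.getLast?_cons]

theorem baseLoc_congr {B : List (CallRec P K)} {B' : List (CallRec P K')}
    (h : List.Forall₂ (fun r r' => r.retLoc = r'.retLoc) B B') (l : P.Loc) :
    baseLoc B l = baseLoc B' l := by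
  induction h generalizing l with
  | nil => rfl
  | cons h _ ih => rw [baseLoc_cons, baseLoc_cons, h, ih]

theorem fnOf_baseLoc_congr (B : List (CallRec P K)) {l l' : P.Loc} (h : P.fnOf l = P.fnOf l') :
    P.fnOf (baseLoc B l) = P.fnOf (baseLoc B l') := by
  cases B with
  | nil => exact h
  | cons r B => rw [baseLoc_cons, baseLoc_cons]

theorem ClassicStep.exists_base {s s' : State P K} (h : ClassicStep P s s')
    {B : List (CallRec P K)} {Ξ : List (StackRec P K)} (hB : s.Ξ = B.map .call ++ Ξ)
    (hlen : Ξ.length ≤ s'.Ξ.length) :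
    ∃ B' : List (CallRec P K), s'.Ξ = B'.map .call ++ Ξ ∧
      P.fnOf (baseLoc B' s'.l) = P.fnOf (baseLoc B s.l) := by
  obtain ⟨ht, hΞ⟩ | ⟨r, ht, hΞ⟩ | ⟨r, hΞ, hl⟩ := h.stack_cases
  · exact ⟨B, hΞ.trans hB, fnOf_baseLoc_congr B (P.fnOf_target _ _ ht)⟩
  · refine ⟨r :: B, by rw [hΞ, hB]; rfl, ?_⟩
    rw [baseLoc_cons]
    exact fnOf_baseLoc_congr B (P.fnOf_target _ _ ht)
  · rw [hΞ] at hB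
    cases B with
    | nil =>
      obtain rfl : _ = Ξ := hB
      exact absurd hlen (Nat.not_succ_le_self _)
    | cons b B =>
      obtain ⟨hb, hΞ'⟩ := List.cons.inj hB
      obtain rfl := StackRec.call.inj hb
      exact ⟨B, hΞ', by rw [baseLoc_cons, hl]⟩

namespace classicTree

variable {u v e : (classicTree P).Vertex}

theorem sat (u : (classicTree P).Vertex) : u.s.φ.Sat := by
  obtain ⟨s, anc, h⟩ := u
  cases h with
  | root => exact ⟨Classical.arbitrary _, Empty.elim, trivial⟩
  | child _ h => exact h.2.2

theorem step (h : u ⋖ v) : ClassicStep P u.s v.s := (Vertex.label_mem_children h).2.1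

theorem not_isFinal_of_lt (h : u < v) : ¬ P.IsFinal u.s.l := by
  obtain ⟨w, huw, -⟩ := exists_covBy_le_of_lt h
  exact (Vertex.label_mem_children huw).1

theorem exists_eq_call_of_mem_stack (u : (classicTree P).Vertex) :
    ∀ x ∈ u.s.Ξ, ∃ r, x = .call r ∧ ¬ P.IsEntry r.retLoc := by
  obtain ⟨s, anc, h⟩ := u
  induction h with
  | root => exact List.forall_mem_nil _
  | child hs hs' ih =>
    obtain ⟨-, hΞ⟩ | ⟨r, ht, hΞ⟩ | ⟨r, hΞ, -⟩ := hs'.2.1.stack_cases <;> dsimp only at ih ⊢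
    · exact hΞ ▸ ih
    · rw [hΞ, List.forall_mem_cons]
      exact ⟨⟨r, rfl, Program.not_isEntry_of_hasTarget ht⟩, ih⟩
    · exact fun x hx => ih x (hΞ ▸ List.mem_cons_of_mem _ hx)

theorem not_isEntry_retLoc {r : CallRec P Empty} {Ξ : List (StackRec P Empty)}
    (h : u.s.Ξ = .call r :: Ξ) : ¬ P.IsEntry r.retLoc := by
  obtain ⟨r', hr', hne⟩ := exists_eq_call_of_mem_stack u _ (h ▸ List.mem_cons_self)
  cases hr'
  exact hne

theorem not_sat_of_isLeaf (he : e.IsLeaf) (hf : ¬ P.IsFinal e.s.l) {s : State P Empty}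
    (h : ClassicStep P e.s s) : ¬ s.φ.Sat :=
  fun hs => Set.eq_empty_iff_forall_notMem.1 he s ⟨hf, h, hs⟩

theorem out_eq_none_of_isLeaf (he : e.IsLeaf) (hf : ¬ P.IsFinal e.s.l) : P.out e.s.l = .none := by
  have stuck {s : State P Empty} (h : ClassicStep P e.s s) : ¬ s.φ.Sat := not_sat_of_isLeaf he hf h
  cases hout : P.out e.s.l with
  | none => rfl
  | single a l' =>
    cases a with
    | assign x t => exact (stuck (.assign x t l' hout) (sat e)).elim
    | call dest f args => exact (stuck (.call dest f args l' hout) (sat e)).elim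
    | ret f t => exact (stuck (.ret f t l' hout) (sat e)).elim
    | skip => exact (stuck (.skip l' hout) (sat e)).elim
  | branch γ l₁ l₂ =>
    obtain ⟨ρ, κ, hφ⟩ := sat e
    by_cases hγ : (e.s.θ.boolIn γ).Holds ρ κ Fin.elim0
    · exact (stuck (.branchTrue γ l₁ l₂ hout) ⟨ρ, κ, hφ, hγ⟩).elim
    · exact (stuck (.branchFalse γ l₁ l₂ hout) ⟨ρ, κ, hφ, hγ⟩).elim

theorem stack_eq_nil_of_isLeaf (he : e.IsLeaf) (hf : ¬ P.IsFinal e.s.l) (hl : P.IsExit e.s.l) :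
    e.s.Ξ = [] := by
  obtain ⟨f, hl⟩ := hl
  match hΞ : e.s.Ξ with
  | [] => rfl
  | x :: Ξ =>
    obtain ⟨r, rfl, -⟩ := exists_eq_call_of_mem_stack e x (hΞ ▸ List.mem_cons_self)
    exact (not_sat_of_isLeaf he hf (.leave f r Ξ hl hΞ) (sat e)).elim

end classicTree

/-- Between `u` and `w` the call stack always has at least `k` records. For `k` the length of the
stack of `u` this is `Inside u w`. -/
def StackLengthGE (k : ℕ) (u w : (classicTree P).Vertex) : Prop :=
  ∀ v : (classicTree P).Vertex, u ≤ v → v ≤ w → k ≤ v.s.Ξ.length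

namespace StackLengthGE

variable {k k' : ℕ} {u u' v w w' : (classicTree P).Vertex}

theorem mono (h : StackLengthGE k u w) (hk : k' ≤ k) (hu : u ≤ u') (hw : w' ≤ w) :
    StackLengthGE k' u' w' :=
  fun v huv hvw => hk.trans (h v (hu.trans huv) (hvw.trans hw))

theorem trans (h : StackLengthGE k u v) (h' : StackLengthGE k v w) (hvw : v ≤ w) :
    StackLengthGE k u w := fun x hux hxw =>
  (Vertex.le_total_of_le hxw hvw).elim (fun hxv => h x hux hxv) fun hvx => h' x hvx hxw

theorem refl (u : (classicTree P).Vertex) : StackLengthGE u.s.Ξ.length u u :=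
  fun _ huv hvu => (le_antisymm huv hvu) ▸ le_rfl

theorem of_covBy (h : u ⋖ v) (hu : k ≤ u.s.Ξ.length) (hv : k ≤ v.s.Ξ.length) :
    StackLengthGE k u v := fun _ hux hxv =>
  (h.eq_or_eq hux hxv).elim (fun hx => hx ▸ hu) fun hx => hx ▸ hv

theorem lt_length_of_isExit (h : StackLengthGE k u w) (huw : u < w) (hl : P.IsExit u.s.l) :
    k < u.s.Ξ.length := by
  obtain ⟨f, hl⟩ := hl
  obtain ⟨v, huv, hvw⟩ := exists_covBy_le_of_lt huw
  obtain ⟨r, Ξ, hΞ, hv⟩ := (classicTree.step huv).eq_leave hl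
  have hk := h v huv.le hvw
  rw [hv] at hk
  rw [hΞ]
  exact Nat.lt_succ_of_le hk

end StackLengthGE

namespace Inside

variable {u w : (classicTree P).Vertex}

theorem exists_stack (huw : u ≤ w) (h : Inside u w) :
    ∃ B : List (CallRec P Empty), w.s.Ξ = B.map .call ++ u.s.Ξ ∧
      P.fnOf (baseLoc B w.s.l) = P.fnOf u.s.l := by
  induction le_iff_reflTransGen_covBy.1 huw with
  | refl => exact ⟨[], rfl, rfl⟩
  | @tail v w huv hvw ih =>
    replace huv := le_iff_reflTransGen_covBy.2 huv
    obtain ⟨B, hB, hfn⟩ := ih huv fun x hux hxv => h x hux (hxv.trans hvw.le)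
    obtain ⟨B', hB', hfn'⟩ := (classicTree.step hvw).exists_base hB (h w huw le_rfl)
    exact ⟨B', hB', hfn'.trans hfn⟩

theorem stack_eq_of_length_eq (huw : u ≤ w) (h : Inside u w)
    (hlen : w.s.Ξ.length = u.s.Ξ.length) : w.s.Ξ = u.s.Ξ := by
  obtain ⟨B, hB, -⟩ := h.exists_stack huw
  have : B = [] := by simpa [hB] using hlen
  simpa [this] using hB

end Inside

end ClassicTree

/-! ### Simulation of the classic tree -/

section Simulation

variable {V : Vocab} {P : Program V}

/-- What the completeness of the recursion template `t` provides for a special record of depth `n`,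
at the vertex `u` of the path to the leaf `e`: if the execution reaches the exit `t.l'` with the
call stack `A` without having had a smaller stack since `u`, then later on it is there again with
the call stack `R`, and `t.θ` describes how the global variables have changed in between. -/
def Pending (e u : (classicTree P).Vertex) (t : RecTemplate P) (n : ℕ)
    (A R : List (StackRec P Empty)) : Prop :=
  ∀ w : (classicTree P).Vertex, u ≤ w → w ≤ e → w.s.l = t.l' → w.s.Ξ = A →
    StackLengthGE A.length u w →
    ∃ u' : (classicTree P).Vertex, w ≤ u' ∧ u' ≤ e ∧ ¬ u'.IsLeaf ∧ StackLengthGE R.length w u' ∧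
      u'.s.Ξ = R ∧ u'.s.GlobalEquiv ⟨w.s.θ.comp (t.θ.value fun _ => n), w.s.φ, R, t.l'⟩

theorem Pending.advance {e u v : (classicTree P).Vertex} {t : RecTemplate P} {n : ℕ}
    {A R : List (StackRec P Empty)} (h : Pending e u t n A R) (huv : u ≤ v)
    (hlen : StackLengthGE A.length u v) : Pending e v t n A R :=
  fun w hvw hwe hl hΞ hw => h w (huv.trans hvw) hwe hl hΞ (hlen.trans hw hvw)

/-- The call stack of the compact tree represents that of the classic tree when its parameters are
read in any `ν ∈ N`. Here `g` is the function of the current activation. A special record represents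
the records `A` of the activations folded in it; the record below it is that of the call at whose
entry its template was instantiated. -/
inductive StackSim (e u : (classicTree P).Vertex) (N : Set (ℕ → ℕ)) :
    P.Fn → List (StackRec P Empty) → List (StackRec P ℕ) → Prop
  | nil (g : P.Fn) : StackSim e u N g [] []
  | call (g : P.Fn) {r : CallRec P Empty} {r' : CallRec P ℕ} {R : List (StackRec P Empty)}
      {R' : List (StackRec P ℕ)} (hr : ∀ ν ∈ N, r.Agrees Empty.elim r' ν)
      (h : StackSim e u N (P.fnOf r.retLoc) R R') :
      StackSim e u N g (.call r :: R) (.call r' :: R')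
  | special {g : P.Fn} {t : RecTemplate P} {κ : ℕ} {A : List (StackRec P Empty)}
      {r : CallRec P Empty} {r' : CallRec P ℕ} {R : List (StackRec P Empty)}
      {R' : List (StackRec P ℕ)} (ht : t.l' = P.exit g) (hA : ∀ ν ∈ N, A.length = ν κ)
      (hr : ∀ ν ∈ N, r.Agrees Empty.elim r' ν) (h : StackSim e u N (P.fnOf r.retLoc) R R')
      (hpending : Pending e u t A.length (A ++ .call r :: R) (.call r :: R)) :
      StackSim e u N g (A ++ .call r :: R) (.special t κ :: .call r' :: R')

namespace StackSim

variable {e u v : (classicTree P).Vertex} {N N' : Set (ℕ → ℕ)} {g : P.Fn}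
  {L : List (StackRec P Empty)} {L' : List (StackRec P ℕ)}

theorem advance (h : StackSim e u N g L L') (huv : u ≤ v) (hlen : StackLengthGE L.length u v) :
    StackSim e v N g L L' := by
  induction h with
  | nil g => exact .nil g
  | call g hr _ ih => exact .call g hr (ih (hlen.mono (Nat.le_succ _) le_rfl le_rfl))
  | @special g t κ A r r' R R' ht hA hr _ hpending ih =>
    have hR : R.length ≤ (A ++ .call r :: R).length := by
      rw [List.length_append, List.length_cons]
      lia
    exact .special ht hA hr (ih (hlen.mono hR le_rfl le_rfl)) (hpending.advance huv hlen)

theorem of_covBy (h : StackSim e u N g L L') (huv : u ⋖ v) (hu : L.length ≤ u.s.Ξ.length)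
    (hv : L.length ≤ v.s.Ξ.length) : StackSim e v N g L L' :=
  h.advance huv.le (.of_covBy huv hu hv)

theorem antitone (h : StackSim e u N g L L') (hN : N' ⊆ N) : StackSim e u N' g L L' := by
  induction h with
  | nil g => exact .nil g
  | call g hr _ ih => exact .call g (fun ν hν => hr ν (hN hν)) ih
  | special ht hA hr _ hpending ih =>
    exact .special ht (fun ν hν => hA ν (hN hν)) (fun ν hν => hr ν (hN hν)) ih hpending

theorem equiv_value (h : StackSim e u N g L L') {ν : ℕ → ℕ} (hν : ν ∈ N) :
    List.Forall₂ StackRec.Equiv L (L'.flatMap (·.value ν)) := by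
  induction h with
  | nil => exact .nil
  | call _ hr _ ih => exact .cons (hr ν hν).equiv_value ih
  | @special _ _ κ A _ _ _ _ _ hA hr _ _ ih =>
    refine List.rel_append ?_ (.cons (hr ν hν).equiv_value ih)
    change List.Forall₂ StackRec.Equiv A (List.replicate (ν κ) .any)
    rw [← hA ν hν, List.forall₂_iff_get]
    refine ⟨List.length_replicate.symm, fun i _ _ => ?_⟩
    simp only [List.get_eq_getElem, List.getElem_replicate]
    cases A[i] <;> trivial

theorem eq_nil_iff (h : StackSim e u N g L L') : L = [] ↔ L' = [] := by
  cases h <;> simp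

theorem ne_any (h : StackSim e u N g L L') (R' : List (StackRec P ℕ)) : L' ≠ .any :: R' := by
  cases h <;> simp

theorem eq_call {r' : CallRec P ℕ} {R' : List (StackRec P ℕ)}
    (h : StackSim e u N g L (.call r' :: R')) :
    ∃ r R, L = .call r :: R ∧ (∀ ν ∈ N, r.Agrees Empty.elim r' ν) ∧
      StackSim e u N (P.fnOf r.retLoc) R R' := by
  cases h with
  | call _ hr h => exact ⟨_, _, rfl, hr, h⟩

theorem eq_special {t : RecTemplate P} {κ : ℕ} {R' : List (StackRec P ℕ)}
    (h : StackSim e u N g L (.special t κ :: R')) :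
    t.l' = P.exit g ∧ ∃ r r' R T, R' = .call r' :: T ∧ (∀ ν ∈ N, r.Agrees Empty.elim r' ν) ∧
      StackSim e u N (P.fnOf r.retLoc) R T ∧
      ∃ n, (∀ ν ∈ N, n = ν κ) ∧ Pending e u t n L (.call r :: R) := by
  cases h with
  | special ht hA hr h hpending => exact ⟨ht, _, _, _, _, rfl, hr, h, _, hA, hpending⟩

theorem push {B : List (CallRec P Empty)} {B' : List (CallRec P ℕ)}
    (hB : List.Forall₂ (fun r r' => ∀ ν ∈ N, r.Agrees Empty.elim r' ν) B B') {l : P.Loc}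
    (h : StackSim e u N (P.fnOf (baseLoc B l)) L L') :
    StackSim e u N (P.fnOf l) (B.map .call ++ L) (B'.map .call ++ L') := by
  induction hB generalizing l with
  | nil => exact h
  | cons hr _ ih =>
    rw [baseLoc_cons] at h
    exact .call _ hr (ih h)

end StackSim

/-- The vertex `u` on the path to the leaf `e` of the classic tree is represented by the state `c`
of the compact tree, for all values `ν ∈ N` of the parameters. The last condition ensures that a
recursion template is only instantiated on top of an ordinary record, as `StackSim` requires. -/
structure Simulates (e u : (classicTree P).Vertex) (c : State P ℕ) (N : Set (ℕ → ℕ)) : Prop where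
  nonempty : N.Nonempty
  mem : ∀ ν ∈ N, u.s.θ.Agrees Empty.elim c.θ ν
  cond : ∀ ν ∈ N, u.s.φ.Agrees Empty.elim c.φ ν
  stack : StackSim e u N (P.fnOf u.s.l) u.s.Ξ c.Ξ
  loc : u.s.l = c.l
  entry : P.IsEntry c.l → c.l = P.entry P.start ∨ ∃ r Ξ, c.Ξ = .call r :: Ξ

namespace Simulates

variable {e u v : (classicTree P).Vertex} {c c' : State P ℕ} {N N' : Set (ℕ → ℕ)}

theorem equiv_value (h : Simulates e u c N) {ν : ℕ → ℕ} (hν : ν ∈ N) : u.s.Equiv (c.value ν) :=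
  ⟨(h.mem ν hν).equiv_value, (h.cond ν hν).equiv_value, h.stack.equiv_value hν, h.loc⟩

theorem sat (h : Simulates e u c N) : c.φ.Sat := by
  obtain ⟨ν, hν⟩ := h.nonempty
  exact (h.cond ν hν).sat (classicTree.sat u)

theorem antitone (h : Simulates e u c N) (hN : N' ⊆ N) (hne : N'.Nonempty) : Simulates e u c N' :=
  ⟨hne, fun ν hν => h.mem ν (hN hν), fun ν hν => h.cond ν (hN hν), h.stack.antitone hN, h.loc,
    h.entry⟩

theorem init (e : (classicTree P).Vertex) (hN : N.Nonempty) :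
    Simulates e ⊥ (State.init P ℕ) N :=
  ⟨hN, fun _ _ _ => rfl, fun _ _ _ => Iff.rfl, .nil _, rfl, fun _ => .inl rfl⟩

theorem exists_eq_call_of_entry (h : Simulates e u c N) {f : P.Fn} (hf : f ≠ P.start)
    (hl : c.l = P.entry f) : ∃ r Ξ, c.Ξ = .call r :: Ξ :=
  (h.entry ⟨f, hl⟩).resolve_left fun hstart => hf (P.entry_injective (hl.symm.trans hstart))

theorem of_target (h : Simulates e u c N) (huv : u ⋖ v) (ht : (P.out u.s.l).HasTarget v.s.l)
    (hΞ : v.s.Ξ = u.s.Ξ) {θ : Mem V ℕ} {φ : BoolExpr V ℕ 0}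
    (hmem : ∀ ν ∈ N, v.s.θ.Agrees Empty.elim θ ν) (hcond : ∀ ν ∈ N, v.s.φ.Agrees Empty.elim φ ν) :
    Simulates e v ⟨θ, φ, c.Ξ, v.s.l⟩ N where
  nonempty := h.nonempty
  mem := hmem
  cond := hcond
  stack := by
    rw [hΞ, P.fnOf_target _ _ ht]
    exact h.stack.of_covBy huv le_rfl (congrArg _ hΞ).ge
  loc := rfl
  entry hentry := absurd hentry (Program.not_isEntry_of_hasTarget ht)

theorem of_leave {w : (classicTree P).Vertex} {f : P.Fn} {r : CallRec P Empty} {r' : CallRec P ℕ}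
    {R : List (StackRec P Empty)} {R' : List (StackRec P ℕ)} {θ : Mem V ℕ} {φ : BoolExpr V ℕ 0}
    (hwv : w ⋖ v) (hl : w.s.l = P.exit f) (hΞ : w.s.Ξ = .call r :: R) (hne : N.Nonempty)
    (hglobal : ∀ ν ∈ N, ∀ ρ : Assignment V, ∀ a, P.owner a = none →
      w.s.θ.den ρ Empty.elim a = θ.den ρ ν a)
    (hcond : ∀ ν ∈ N, w.s.φ.Agrees Empty.elim φ ν) (hr : ∀ ν ∈ N, r.Agrees Empty.elim r' ν)
    (hR : StackSim e w N (P.fnOf r.retLoc) R R') :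
    Simulates e v ⟨θ.leave P f r', φ, R', r'.retLoc⟩ N := by
  obtain ⟨ν₀, hν₀⟩ := hne
  obtain ⟨r₀, R₀, hΞ₀, hv⟩ := (classicTree.step hwv).eq_leave hl
  obtain ⟨rfl, rfl⟩ : r = r₀ ∧ R = R₀ := by simpa [hΞ] using hΞ₀
  refine ⟨⟨ν₀, hν₀⟩, fun ν hν => ?_, fun ν hν => ?_, ?_, ?_, fun hentry => ?_⟩
  · rw [hv]
    exact .leave (hglobal ν hν) f (hr ν hν)
  · rw [hv]
    exact hcond ν hν
  · have hR' := hR.of_covBy hwv (hΞ ▸ Nat.le_succ _) (hv ▸ le_rfl)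
    rwa [hv]
  · rw [hv]
    exact (hr ν₀ hν₀).retLoc
  · exact absurd ((hr ν₀ hν₀).retLoc ▸ hentry) (classicTree.not_isEntry_retLoc hΞ)

theorem exists_leave (h : Simulates e u c N) (hc : ¬ Unwinds c) (huv : u ⋖ v) {f : P.Fn}
    (hl : u.s.l = P.exit f) : ∃ c', ClassicStep P c c' ∧ Simulates e v c' N := by
  obtain ⟨r, R, hΞ, -⟩ := (classicTree.step huv).eq_leave hl
  match hcΞ : c.Ξ with
  | [] => cases hΞ.symm.trans (h.stack.eq_nil_iff.2 hcΞ)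
  | .any :: Ξ => exact absurd hcΞ (h.stack.ne_any Ξ)
  | .special t κ :: Ξ =>
    obtain ⟨ht, -⟩ := (hcΞ ▸ h.stack).eq_special
    rw [hl, P.fnOf_exit] at ht
    exact absurd ⟨t, κ, Ξ, hcΞ, h.loc.symm.trans (hl.trans ht.symm)⟩ hc
  | .call r' :: Ξ =>
    obtain ⟨r₀, R₀, hΞ₀, hr, hR⟩ := (hcΞ ▸ h.stack).eq_call
    obtain ⟨rfl, rfl⟩ : r = r₀ ∧ R = R₀ := by simpa [hΞ] using hΞ₀
    exact ⟨_, .leave f r' Ξ (h.loc ▸ hl) hcΞ, of_leave huv hl hΞ h.nonempty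
      (fun ν hν ρ a _ => congrFun (h.mem ν hν ρ) a) h.cond hr hR⟩

theorem exists_classicStep (h : Simulates e u c N) (hc : ¬ Unwinds c) (huv : u ⋖ v) :
    ∃ c', ClassicStep P c c' ∧ Simulates e v c' N := by
  obtain ⟨s, anc, hs⟩ := v
  have hstep : ClassicStep P u.s s := classicTree.step huv
  cases hstep with
  | assign x t l' hout =>
    exact ⟨_, .assign x t l' (h.loc ▸ hout), h.of_target huv (by rw [hout]; rfl) rfl
      (fun ν hν => (h.mem ν hν).set_exprIn x t) h.cond⟩
  | skip l' hout =>
    exact ⟨_, .skip l' (h.loc ▸ hout), h.of_target huv (by rw [hout]; rfl) rfl h.mem h.cond⟩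
  | ret f t l' hout =>
    exact ⟨_, .ret f t l' (h.loc ▸ hout), h.of_target huv (by rw [hout]; rfl) rfl
      (fun ν hν => (h.mem ν hν).set_exprIn (P.ret f) t) h.cond⟩
  | branchTrue γ l₁ l₂ hout =>
    exact ⟨_, .branchTrue γ l₁ l₂ (h.loc ▸ hout), h.of_target huv (by rw [hout]; exact .inl rfl) rfl
      h.mem fun ν hν => (h.cond ν hν).and_boolIn (h.mem ν hν) γ⟩
  | branchFalse γ l₁ l₂ hout =>
    exact ⟨_, .branchFalse γ l₁ l₂ (h.loc ▸ hout),
      h.of_target huv (by rw [hout]; exact .inr rfl) rfl h.mem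
        fun ν hν => (h.cond ν hν).and_boolIn (h.mem ν hν) γ.neg⟩
  | call dest f args l' hout =>
    have ht : (P.out u.s.l).HasTarget l' := by rw [hout]; rfl
    refine ⟨_, .call dest f args l' (h.loc ▸ hout), h.nonempty,
      fun ν hν => (h.mem ν hν).enter f args, h.cond, ?_, rfl, fun _ => .inr ⟨_, _, rfl⟩⟩
    rw [← h.loc]
    refine .call _ (fun ν hν => (h.mem ν hν).locals _ l' dest) ?_
    rw [P.fnOf_target _ _ ht]
    exact h.stack.of_covBy huv le_rfl (Nat.le_succ _)
  | leave f r R hl hΞ => exact h.exists_leave hc huv hl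

theorem exists_unwind (h : Simulates e u c N) (he : e.IsLeaf) (hue : u ≤ e) {t : RecTemplate P}
    {κ : ℕ} {Ξ : List (StackRec P ℕ)} (hΞ : c.Ξ = .special t κ :: Ξ) (hl : c.l = t.l') :
    ∃ f r Ξ', t.l' = P.exit f ∧ Ξ = .call r :: Ξ' ∧ ∃ v, u < v ∧ v ≤ e ∧
      Simulates e v
        ⟨(c.θ.comp (t.θ.rename fun _ => κ)).leave P f r, c.φ, Ξ', r.retLoc⟩ N := by
  obtain ⟨ht, r, r', R, T, rfl, hr, hR, n, hn, hpending⟩ := (hΞ ▸ h.stack).eq_special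
  obtain ⟨u', huu', hu'e, hleaf, hlen, hΞ', hmem, hcond, -, hl'⟩ :=
    hpending u le_rfl hue (h.loc.trans hl) rfl (.refl u)
  obtain ⟨v, hu'v, hve⟩ := exists_covBy_le_of_lt (hu'e.lt_of_ne fun heq => hleaf (heq ▸ he))
  refine ⟨_, r', T, ht, rfl, v, huu'.trans_lt hu'v.lt, hve,
    of_leave hu'v (hl'.trans ht) hΞ' h.nonempty (fun ν hν ρ a ha => ?_)
      (fun ν hν ρ => (hcond ρ _).trans (h.cond ν hν ρ)) hr
      (hR.advance huu' (hlen.mono (Nat.le_succ _) le_rfl le_rfl))⟩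
  calc u'.s.θ.den ρ Empty.elim a
      = (u.s.θ.comp (t.θ.value fun _ => n)).den ρ Empty.elim a := hmem a ha ρ _
    _ = (c.θ.comp (t.θ.rename fun _ => κ)).den ρ ν a := by
      rw [Mem.den_comp, Mem.den_value, Mem.den_comp, Mem.den_rename, h.mem ν hν ρ, hn ν hν]

end Simulates

end Simulation

/-! ### Instantiation of templates -/

section Instantiation

variable {V : Vocab} {P : Program V}

section Stack

variable {K : Type}

theorem exists_split_of_forall₂_equiv {C : List (CallRec P K)} {X : List (CallRec P K)} {m : ℕ}
    {Ξ : List (StackRec P K)}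
    (h : List.Forall₂ StackRec.Equiv (C.map .call ++ Ξ)
      (X.map .call ++ (List.replicate m .any ++ Ξ))) :
    ∃ B A, C = B ++ A ∧ A.length = m ∧ List.Forall₂ CallRec.Equiv B X := by
  have hlen : C.length = X.length + m := by
    have := h.length_eq
    simp only [List.length_append, List.length_map, List.length_replicate] at this
    lia
  refine ⟨C.take X.length, C.drop X.length, (List.take_append_drop _ _).symm, ?_, ?_⟩
  · rw [List.length_drop, hlen, Nat.add_sub_cancel_left]
  · have := List.forall₂_take X.length h
    rw [List.take_append_of_le_length (by simp [hlen]), ← List.map_take,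
      List.take_left' (List.length_map _), List.forall₂_map_left_iff,
      List.forall₂_map_right_iff] at this
    exact this

theorem GenTemplate.stack_comp_value_exitState (t : GenTemplate P) (i : Fin t.n)
    (s : State P Empty) (ν : Unit → ℕ) :
    (s.comp ((t.exitState i).value ν)).Ξ =
      ((t.exits i).Ξ.map fun x => (x.value ν).comp s.θ).map .call ++ s.Ξ := by
  simp only [State.comp, State.value, exitState, List.flatMap_map, StackRec.value,
    ← List.map_eq_flatMap, List.map_map, Function.comp_def, StackRec.comp]

theorem GenTemplate.stack_comp_rename_exitState (t : GenTemplate P) (i : Fin t.n)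
    (c : State P K) (f : Unit → K) :
    (c.comp ((t.exitState i).rename f)).Ξ =
      ((t.exits i).Ξ.map fun x => (x.rename f).comp c.θ).map .call ++ c.Ξ := by
  simp only [State.comp, State.rename, exitState, List.map_map, Function.comp_def, StackRec.rename,
    StackRec.comp]

theorem RecTemplate.stack_comp_value_exitState (t : RecTemplate P) (i : Fin t.n)
    (s : State P Empty) (ν : Unit → ℕ) :
    (s.comp ((t.exitState i).value ν)).Ξ =
      ((t.exits i).Ξ.map fun x => (x.value ν).comp s.θ).map .call ++
        (List.replicate (ν ()) .any ++ s.Ξ) := by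
  simp only [State.comp, State.value, exitState, List.flatMap_append, List.flatMap_map,
    StackRec.value, ← List.map_eq_flatMap, List.flatMap_singleton, List.map_append, List.map_map,
    List.map_replicate, Function.comp_def, StackRec.comp, List.append_assoc]

theorem RecTemplate.stack_comp_rename_exitState (t : RecTemplate P) (i : Fin t.n)
    (c : State P K) (f : Unit → K) :
    (c.comp ((t.exitState i).rename f)).Ξ =
      ((t.exits i).Ξ.map fun x => (x.rename f).comp c.θ).map .call ++
        .special t (f ()) :: c.Ξ := by
  simp only [State.comp, State.rename, exitState, List.map_append, List.map_map,
    Function.comp_def, StackRec.rename, StackRec.comp, List.map_cons, List.map_nil,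
    List.append_assoc, List.singleton_append]

end Stack

/-- What the completeness of compact execution needs of a template: its exits cover the executions
from its entry location to a leaf. They need be neither reachable nor mutually exclusive. -/
structure GenTemplate.IsCover (t : GenTemplate P) : Prop where
  l_not_exit : ¬ P.IsExit t.l
  exits_not_entry : ∀ i, ¬ P.IsEntry (t.exits i).l
  complete : ∀ u e : (classicTree P).Vertex, u.s.l = t.l → u ≤ e → e.IsLeaf →
    ∃ w : (classicTree P).Vertex, u < w ∧ w ≤ e ∧ Inside u w ∧
      ∃ (i : Fin t.n) (ν : ℕ), w.s.Equiv (u.s.comp ((t.exitState i).value fun _ => ν))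

theorem GenTemplate.IsTemplate.isCover {t : GenTemplate P} (ht : t.IsTemplate) : t.IsCover where
  l_not_exit := ht.l_not_exit
  exits_not_entry i := (ht.basic.2.2.2 i).1
  complete := ht.complete

/-- The analogue of `GenTemplate.IsCover` for recursion templates; the function `f` need not be
called, as long as it is not the starting function. -/
structure RecTemplate.IsCover (t : RecTemplate P) : Prop where
  exits_not_entry : ∀ i, ¬ P.IsEntry (t.exits i).l
  exits_not_exit : ∀ i, ¬ P.IsExit (t.exits i).l
  function : ∃ f : P.Fn, f ≠ P.start ∧ t.l = P.entry f ∧ t.l' = P.exit f ∧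
    ∀ i, (t.exits i).LiesIn f
  complete : ∀ u e : (classicTree P).Vertex, u.s.l = t.l → u ≤ e → e.IsLeaf →
    ∃ w : (classicTree P).Vertex, u < w ∧ w ≤ e ∧ Inside u w ∧
      ∃ (i : Fin t.n) (ν : ℕ), w.s.Equiv (u.s.comp ((t.exitState i).value fun _ => ν)) ∧
        ∀ w' : (classicTree P).Vertex, w < w' → w' ≤ e →
          ReturnsTo w w' (t.exits i).Ξ.length t.l' →
          (∀ v : (classicTree P).Vertex, w < v → v < w' →
            ¬ ReturnsTo w v (t.exits i).Ξ.length t.l') →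
          ∃ u' : (classicTree P).Vertex, w' ≤ u' ∧ u' ≤ e ∧ ¬ u'.IsLeaf ∧ Inside u u' ∧
            u'.s.GlobalEquiv ⟨w'.s.θ.comp (t.θ.value fun _ => ν), w'.s.φ, u.s.Ξ, t.l'⟩

theorem RecTemplate.IsTemplate.isCover {t : RecTemplate P} (ht : t.IsTemplate) : t.IsCover where
  exits_not_entry i := (ht.basic.2.2.2 i).1
  exits_not_exit i := (ht.basic.2.2.2 i).2
  function := by
    obtain ⟨f, hl, hl', hf, _, _, _, _, hcall⟩ := ht.function
    exact ⟨f, (P.call_ok _ _ _ _ _ hcall).1, hl, hl', hf⟩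
  complete u e hu hue he := by
    obtain ⟨w, huw, hwe, -, hw⟩ := ht.complete u e hu hue he
    exact ⟨w, huw, hwe, hw⟩

theorem RecTemplate.IsCover.exists_pending {t : RecTemplate P} (ht : t.IsCover)
    {u e : (classicTree P).Vertex} (hu : u.s.l = t.l) (hue : u ≤ e) (he : e.IsLeaf) :
    ∃ w : (classicTree P).Vertex, u < w ∧ w ≤ e ∧ Inside u w ∧ ∃ (i : Fin t.n) (n : ℕ),
      w.s.Equiv (u.s.comp ((t.exitState i).value fun _ => n)) ∧
      Pending e w t n (w.s.Ξ.drop (t.exits i).Ξ.length) u.s.Ξ := by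
  obtain ⟨f, -, -, hf, -⟩ := ht.function
  obtain ⟨w, huw, hwe, hin, i, n, hw, hreturn⟩ := ht.complete u e hu hue he
  refine ⟨w, huw, hwe, hin, i, n, hw, fun w' hww' hw'e hl' hΞ' hlen => ?_⟩
  have ne : w ≠ w' := by
    rintro rfl
    exact ht.exits_not_exit i ⟨f, hw.2.2.2.symm.trans (hl'.trans hf)⟩
  have first (v : (classicTree P).Vertex) (hwv : w < v) (hvw' : v < w') :
      ¬ ReturnsTo w v (t.exits i).Ξ.length t.l' := fun hv =>
    ((hlen.mono le_rfl hwv.le le_rfl).lt_length_of_isExit hvw' ⟨f, hv.1.trans hf⟩).ne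
      (congrArg _ hv.2.symm)
  obtain ⟨u', hw'u', hu'e, hleaf, hin', hu'⟩ :=
    hreturn w' (hww'.lt_of_ne ne) hw'e ⟨hl', hΞ'⟩ first
  have huw' := huw.le.trans hww'
  exact ⟨u', hw'u', hu'e, hleaf, StackLengthGE.mono hin' le_rfl huw' le_rfl,
    hin'.stack_eq_of_length_eq (huw'.trans hw'u') hu'.2.2.1.length_eq, hu'⟩

namespace Template

/-- The analogue of `GenTemplate.IsCover` for tuples of both kinds. -/
def IsCover : Template P → Prop
  | general t => t.IsCover
  | recursion t => t.IsCover

theorem IsTemplate.isCover {t : Template P} (ht : t.IsTemplate) : t.IsCover := by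
  cases t with
  | general t => exact GenTemplate.IsTemplate.isCover ht
  | recursion t => exact RecTemplate.IsTemplate.isCover ht

theorem IsCover.not_isExit {t : Template P} (ht : t.IsCover) : ¬ P.IsExit t.l := by
  cases t with
  | general t => exact GenTemplate.IsCover.l_not_exit ht
  | recursion t =>
    obtain ⟨f, -, hl, -⟩ := RecTemplate.IsCover.function ht
    rintro ⟨g, hg⟩
    exact P.not_isEntry_exit g ⟨f, hg.symm.trans hl⟩

theorem IsCover.not_isLeaf {t : Template P} (ht : t.IsCover) {u : (classicTree P).Vertex}
    (hu : u.s.l = t.l) : ¬ u.IsLeaf := by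
  intro hleaf
  cases t with
  | general t =>
    obtain ⟨w, huw, hw, -⟩ := GenTemplate.IsCover.complete ht u u hu le_rfl hleaf
    exact huw.not_ge hw
  | recursion t =>
    obtain ⟨w, huw, hw, -⟩ := RecTemplate.IsCover.complete ht u u hu le_rfl hleaf
    exact huw.not_ge hw

end Template

theorem forall₂_agrees_of_forall₂_equiv {N : Set (ℕ → ℕ)} {θ : Mem V Empty} {θ' : Mem V ℕ}
    (hθ : ∀ ν ∈ N, θ.Agrees Empty.elim θ' ν) {n κ : ℕ} (hκ : ∀ ν ∈ N, ν κ = n)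
    {B : List (CallRec P Empty)} {X : List (CallRec P Unit)}
    (hB : List.Forall₂ CallRec.Equiv B (X.map fun x => (x.value fun _ => n).comp θ)) :
    List.Forall₂ (fun r r' => ∀ ν ∈ N, r.Agrees Empty.elim r' ν) B
      (X.map fun x => (x.rename fun _ => κ).comp θ') := by
  rw [List.forall₂_map_right_iff] at hB ⊢
  refine hB.imp fun r x hrx ν hν => ?_
  obtain rfl := hκ ν hν
  exact .of_equiv_comp (hθ ν hν) hrx

namespace Simulates

variable {e u w : (classicTree P).Vertex} {c : State P ℕ} {N : Set (ℕ → ℕ)} {κ n : ℕ}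

theorem of_equiv_comp (h : Simulates e u c N) (hκ : ∀ ν ∈ N, ν κ = n) {x : State P Unit}
    (hw : w.s.Equiv (u.s.comp (x.value fun _ => n))) (hx : ¬ P.IsEntry x.l)
    (hstack : StackSim e w N (P.fnOf w.s.l) w.s.Ξ (c.comp (x.rename fun _ => κ)).Ξ) :
    Simulates e w (c.comp (x.rename fun _ => κ)) N where
  nonempty := h.nonempty
  mem ν hν := by
    obtain rfl := hκ ν hν
    exact (h.mem ν hν).of_equiv_comp hw.1
  cond ν hν := by
    obtain rfl := hκ ν hν
    exact (h.cond ν hν).of_equiv_and_subst (h.mem ν hν) hw.2.1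
  stack := hstack
  loc := hw.2.2.2
  entry hentry := absurd hentry hx

theorem of_general_exit (h : Simulates e u c N) (hκ : ∀ ν ∈ N, ν κ = n) {t : GenTemplate P}
    (ht : t.IsCover) {i : Fin t.n} (huw : u ≤ w) (hin : Inside u w)
    (hw : w.s.Equiv (u.s.comp ((t.exitState i).value fun _ => n))) :
    Simulates e w (c.comp ((t.exitState i).rename fun _ => κ)) N := by
  refine h.of_equiv_comp hκ hw (ht.exits_not_entry i) ?_
  have hΞ := hw.2.2.1
  obtain ⟨C, hC, hfn⟩ := hin.exists_stack huw
  rw [hC, t.stack_comp_value_exitState] at hΞ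
  obtain ⟨B, A, rfl, hA, hB⟩ := exists_split_of_forall₂_equiv (m := 0) hΞ
  obtain rfl := List.eq_nil_of_length_eq_zero hA
  rw [List.append_nil] at hC hfn
  rw [hC, t.stack_comp_rename_exitState]
  refine .push (forall₂_agrees_of_forall₂_equiv h.mem hκ hB) ?_
  rw [hfn]
  exact h.stack.advance huw hin

theorem stackSim_special (h : Simulates e u c N) {t : RecTemplate P} {f : P.Fn}
    (hf : t.l' = P.exit f) (huw : u ≤ w) (hin : Inside u w) {r : CallRec P ℕ}
    {R : List (StackRec P ℕ)} (hc : c.Ξ = .call r :: R) {A : List (StackRec P Empty)}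
    (hA : ∀ ν ∈ N, A.length = ν κ)
    (hpending : Pending e w t A.length (A ++ u.s.Ξ) u.s.Ξ) :
    StackSim e w N f (A ++ u.s.Ξ) (.special t κ :: c.Ξ) := by
  obtain ⟨r₀, R₀, hu, hr, hR⟩ := (hc ▸ h.stack).eq_call
  rw [hu] at hpending
  rw [hu, hc]
  exact .special hf hA hr
    (hR.advance huw (StackLengthGE.mono hin (hu ▸ Nat.le_succ _) le_rfl le_rfl)) hpending

theorem of_recursion_exit (h : Simulates e u c N) (hκ : ∀ ν ∈ N, ν κ = n) {t : RecTemplate P}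
    (ht : t.IsCover) (hl : t.l = c.l) {i : Fin t.n} (huw : u ≤ w) (hin : Inside u w)
    (hw : w.s.Equiv (u.s.comp ((t.exitState i).value fun _ => n)))
    (hpending : Pending e w t n (w.s.Ξ.drop (t.exits i).Ξ.length) u.s.Ξ) :
    Simulates e w (c.comp ((t.exitState i).rename fun _ => κ)) N := by
  obtain ⟨f, hstart, hlf, hlf', hlies⟩ := ht.function
  obtain ⟨r, R, hc⟩ := h.exists_eq_call_of_entry hstart (hl.symm.trans hlf)
  refine h.of_equiv_comp hκ hw (ht.exits_not_entry i) ?_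
  have hΞ := hw.2.2.1
  obtain ⟨C, hC, -⟩ := hin.exists_stack huw
  rw [hC, t.stack_comp_value_exitState] at hΞ
  obtain ⟨B, A, rfl, hA, hB⟩ := exists_split_of_forall₂_equiv hΞ
  have hBX := forall₂_agrees_of_forall₂_equiv h.mem hκ hB
  rw [List.map_append, List.append_assoc] at hC
  rw [hC, t.stack_comp_rename_exitState]
  refine .push hBX ?_
  have base_mem : P.fnOf (baseLoc B w.s.l) = f := by
    obtain ⟨ν, hν⟩ := h.nonempty
    have hX : List.Forall₂ (fun r x => r.retLoc = x.retLoc) B (t.exits i).Ξ :=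
      (List.forall₂_map_right_iff.1 hBX).imp fun _ _ h => (h ν hν).retLoc
    rw [baseLoc_congr hX, hw.2.2.2]
    exact hlies i
  rw [base_mem]
  refine h.stackSim_special hlf' huw hin hc (fun ν hν => by rw [List.length_map, hA, hκ ν hν]) ?_
  have hBlen : (B.map (StackRec.call (K := Empty))).length = (t.exits i).Ξ.length := by
    simpa using hB.length_eq
  rwa [hC, List.drop_left' hBlen, ← hA, ← List.length_map (f := StackRec.call)] at hpending

theorem exists_instance (h : Simulates e u c N) (he : e.IsLeaf) (hue : u ≤ e)
    {p : Set (Template P)} (hi : Instantiates p c) {t : Template P} (ht : t.IsCover)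
    (hl : t.l = c.l) (hκ : ∀ n, ∃ ν ∈ N, ν κ = n) :
    ∃ v, u < v ∧ v ≤ e ∧ ∃ c' n, CompactStep p c t κ c' ∧ Simulates e v c' {ν ∈ N | ν κ = n} := by
  have restrict (n : ℕ) : Simulates e u c {ν ∈ N | ν κ = n} :=
    h.antitone (Set.sep_subset _ _) (hκ n)
  cases t with
  | general t =>
    replace ht : t.IsCover := ht
    obtain ⟨w, huw, hwe, hin, i, n, hw⟩ := ht.complete u e (h.loc.trans hl.symm) hue he
    exact ⟨w, huw, hwe, _, n, .general hi t rfl i,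
      (restrict n).of_general_exit (fun _ hν => hν.2) ht huw.le hin hw⟩
  | recursion t =>
    replace ht : t.IsCover := ht
    obtain ⟨w, huw, hwe, hin, i, n, hw, hpending⟩ := ht.exists_pending (h.loc.trans hl.symm) hue he
    exact ⟨w, huw, hwe, _, n, .recursion hi t rfl i,
      (restrict n).of_recursion_exit (fun _ hν => hν.2) ht hl huw.le hin hw hpending⟩

end Simulates

end Instantiation

/-! ### Soundness of compact symbolic execution -/

section Compact

variable {V : Vocab} {P : Program V} {p : Set (Template P)}
  {choose : State P ℕ → List (State P ℕ) → Template P}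
  {fresh : State P ℕ → List (State P ℕ) → ℕ}
  {e u : (classicTree P).Vertex} {c c' : (compactTree p choose fresh).Vertex} {ν : ℕ → ℕ}

/-- The parameters introduced by the template instantiations at the proper ancestors of `c`. -/
def usedParams (c : (compactTree p choose fresh).Vertex) : Set ℕ :=
  {κ | ∃ a : (compactTree p choose fresh).Vertex, a < c ∧ Instantiates p a.s ∧ fresh a.s a.anc = κ}

theorem usedParams_mono (h : c ≤ c') : usedParams c ⊆ usedParams c' := by
  rintro κ ⟨a, ha, hi, rfl⟩
  exact ⟨a, ha.trans_le h, hi, rfl⟩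

theorem fresh_mem_usedParams (h : c < c') (hi : Instantiates p c.s) :
    fresh c.s c.anc ∈ usedParams c' :=
  ⟨c, h, hi, rfl⟩

theorem fresh_notMem_usedParams
    (hfresh : ∀ u v : (compactTree p choose fresh).Vertex, u < v →
      Instantiates p u.s → Instantiates p v.s → fresh u.s u.anc ≠ fresh v.s v.anc)
    (hi : Instantiates p c.s) : fresh c.s c.anc ∉ usedParams c := by
  rintro ⟨a, hac, hia, ha⟩
  exact hfresh a c hac hia hi ha

theorem not_instantiates_exit (hp : ∀ t ∈ p, t.IsCover) {s : State P ℕ} (hs : P.IsExit s.l) :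
    ¬ Instantiates p s := by
  rintro ⟨-, -, t, ht, hl⟩
  exact (hp t ht).not_isExit (hl ▸ hs)

/-- The vertex `u` on the path to `e` is represented by the vertex `c` of the compact tree when the
parameters introduced so far have the values `ν`; those still to be introduced are arbitrary. -/
def Represents (e u : (classicTree P).Vertex) (c : (compactTree p choose fresh).Vertex)
    (ν : ℕ → ℕ) : Prop :=
  Simulates e u c.s {ν' | Set.EqOn ν' ν (usedParams c)}

namespace Represents

theorem of_le (hc : c ≤ c') (h : Simulates e u c'.s {ν' | Set.EqOn ν' ν (usedParams c)}) :
    Represents e u c' ν :=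
  h.antitone (fun _ hν => Set.EqOn.mono (usedParams_mono hc) hν) ⟨ν, fun _ _ => rfl⟩

theorem exists_step_of_unwinds (hp : ∀ t ∈ p, t.IsCover) (he : e.IsLeaf) (hue : u < e)
    (h : Represents e u c ν) (hu : Unwinds c.s) :
    ∃ v, u < v ∧ v ≤ e ∧ ∃ (c' : (compactTree p choose fresh).Vertex) (ν' : ℕ → ℕ),
      Represents e v c' ν' := by
  obtain ⟨t, κ, Ξ, hΞ, hl⟩ := hu
  have hfin : ¬ P.IsFinal c.s.l := h.loc ▸ classicTree.not_isFinal_of_lt hue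
  obtain ⟨f, r, Ξ', hf, rfl, v, huv, hve, hv⟩ := h.exists_unwind he hue.le hΞ hl
  let c₁ := c.child ⟨c.s.θ.comp (t.θ.rename fun _ => κ), c.s.φ, .call r :: Ξ', t.l'⟩
    ⟨hfin, .unwind t κ _ hΞ hl, h.sat⟩
  have not_unwinds : ¬ Unwinds c₁.s := by
    rintro ⟨_, _, _, hcall, -⟩
    cases hcall
  let c₂ := c₁.child _ ⟨show ¬ P.IsFinal t.l' from hl ▸ hfin,
    .classic not_unwinds (not_instantiates_exit hp ⟨f, hf⟩) _ (.leave f r Ξ' hf rfl), hv.sat⟩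
  have hle : c ≤ c₂ := (Vertex.covBy_child _).le.trans (Vertex.covBy_child _).le
  exact ⟨v, huv, hve, c₂, ν, of_le hle hv⟩

theorem exists_step_of_instantiates (hp : ∀ t ∈ p, t.IsCover)
    (hchoose : ∀ s anc, (∃ t ∈ p, t.l = s.l) → choose s anc ∈ p ∧ (choose s anc).l = s.l)
    (hfresh : ∀ u v : (compactTree p choose fresh).Vertex, u < v →
      Instantiates p u.s → Instantiates p v.s → fresh u.s u.anc ≠ fresh v.s v.anc)
    (he : e.IsLeaf) (hue : u ≤ e) (h : Represents e u c ν) (hi : Instantiates p c.s) :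
    ∃ v, u < v ∧ v ≤ e ∧ ∃ (c' : (compactTree p choose fresh).Vertex) (ν' : ℕ → ℕ),
      Represents e v c' ν' := by
  obtain ⟨hmem, hl⟩ := hchoose c.s c.anc hi.2.2
  have hκ := fresh_notMem_usedParams hfresh hi
  have update_eqOn (n : ℕ) :
      Set.EqOn (Function.update ν (fresh c.s c.anc) n) ν (usedParams c) :=
    fun k hk => Function.update_of_ne (ne_of_mem_of_not_mem hk hκ) _ _
  obtain ⟨v, huv, hve, s', n, hstep, hv⟩ := h.exists_instance he hue hi (hp _ hmem) hl
    fun n => ⟨_, update_eqOn n, Function.update_self ..⟩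
  let c' := c.child s' ⟨hi.1, hstep, hv.sat⟩
  have hcc' : c < c' := (Vertex.covBy_child _).lt
  refine ⟨v, huv, hve, c', Function.update ν (fresh c.s c.anc) n,
    hv.antitone (fun ν' hν' => ⟨?_, ?_⟩) ⟨_, fun _ _ => rfl⟩⟩
  · exact (Set.EqOn.mono (usedParams_mono hcc'.le) hν').trans (update_eqOn n)
  · rw [hν' (fresh_mem_usedParams hcc' hi), Function.update_self]

theorem exists_step_of_classic (hue : u < e) (h : Represents e u c ν) (hu : ¬ Unwinds c.s)
    (hi : ¬ Instantiates p c.s) :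
    ∃ v, u < v ∧ v ≤ e ∧ ∃ (c' : (compactTree p choose fresh).Vertex) (ν' : ℕ → ℕ),
      Represents e v c' ν' := by
  have hfin : ¬ P.IsFinal c.s.l := h.loc ▸ classicTree.not_isFinal_of_lt hue
  obtain ⟨v, huv, hve⟩ := exists_covBy_le_of_lt hue
  obtain ⟨s', hs', hv⟩ := h.exists_classicStep hu huv
  let c' := c.child s' ⟨hfin, .classic hu hi s' hs', hv.sat⟩
  exact ⟨v, huv.lt, hve, c', ν, of_le (Vertex.covBy_child _).le hv⟩

theorem exists_step (hp : ∀ t ∈ p, t.IsCover)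
    (hchoose : ∀ s anc, (∃ t ∈ p, t.l = s.l) → choose s anc ∈ p ∧ (choose s anc).l = s.l)
    (hfresh : ∀ u v : (compactTree p choose fresh).Vertex, u < v →
      Instantiates p u.s → Instantiates p v.s → fresh u.s u.anc ≠ fresh v.s v.anc)
    (he : e.IsLeaf) (hue : u < e) (h : Represents e u c ν) :
    ∃ v, u < v ∧ v ≤ e ∧ ∃ (c' : (compactTree p choose fresh).Vertex) (ν' : ℕ → ℕ),
      Represents e v c' ν' := by
  by_cases hu : Unwinds c.s
  · exact h.exists_step_of_unwinds hp he hue hu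
  by_cases hi : Instantiates p c.s
  · exact h.exists_step_of_instantiates hp hchoose hfresh he hue.le hi
  · exact h.exists_step_of_classic hue hu hi

theorem not_unwinds_of_isLeaf (he : e.IsLeaf) (h : Represents e e c ν) : ¬ Unwinds c.s := by
  rintro ⟨t, κ, Ξ, hΞ, hl⟩
  obtain ⟨-, -, -, -, -, v, hev, hve, -⟩ := h.exists_unwind he le_rfl hΞ hl
  exact hev.not_ge hve

theorem not_instantiates_of_isLeaf (hp : ∀ t ∈ p, t.IsCover) (he : e.IsLeaf)
    (h : Represents e e c ν) : ¬ Instantiates p c.s := by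
  rintro ⟨-, -, t, ht, hl⟩
  exact (hp t ht).not_isLeaf (h.loc.trans hl.symm) he

theorem not_classicStep_of_isLeaf (he : e.IsLeaf) (h : Represents e e c ν)
    (hfin : ¬ P.IsFinal c.s.l) (s : State P ℕ) : ¬ ClassicStep P c.s s := by
  have hfin' : ¬ P.IsFinal e.s.l := h.loc ▸ hfin
  have hout : P.out c.s.l = .none := h.loc ▸ classicTree.out_eq_none_of_isLeaf he hfin'
  intro hs
  cases hs with
  | leave f r Ξ hl hΞ =>
    have hnil := classicTree.stack_eq_nil_of_isLeaf he hfin' ⟨f, h.loc.trans hl⟩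
    cases hΞ.symm.trans (h.stack.eq_nil_iff.1 hnil)
  | _ => simp_all only [reduceCtorEq]

theorem isLeaf (hp : ∀ t ∈ p, t.IsCover) (he : e.IsLeaf) (h : Represents e e c ν) :
    c.IsLeaf := by
  refine Set.eq_empty_iff_forall_notMem.2 ?_
  rintro s ⟨hfin, hstep, -⟩
  cases hstep with
  | unwind t κ Ξ hΞ hl => exact h.not_unwinds_of_isLeaf he ⟨t, κ, Ξ, hΞ, hl⟩
  | recursion hi => exact h.not_instantiates_of_isLeaf hp he hi
  | general hi => exact h.not_instantiates_of_isLeaf hp he hi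
  | classic _ _ _ hs => exact h.not_classicStep_of_isLeaf he hfin s hs

end Represents

end Compact

end CSE

theorem mainTheorem1_general {V : CSE.Vocab} (P : CSE.Program V)
    (p : Set (CSE.Template P)) (hp : ∀ t ∈ p, t.IsCover)
    (choose : CSE.State P ℕ → List (CSE.State P ℕ) → CSE.Template P)
    (hchoose : ∀ s anc, (∃ t ∈ p, t.l = s.l) → choose s anc ∈ p ∧ (choose s anc).l = s.l)
    (fresh : CSE.State P ℕ → List (CSE.State P ℕ) → ℕ)
    (hfresh : ∀ u v : (CSE.compactTree p choose fresh).Vertex, u < v →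
      CSE.Instantiates p u.s → CSE.Instantiates p v.s → fresh u.s u.anc ≠ fresh v.s v.anc)
    (e : (CSE.classicTree P).Vertex) (he : e.IsLeaf) :
    ∃ e' : (CSE.compactTree p choose fresh).Vertex, e'.IsLeaf ∧
      ∃ ν : ℕ → ℕ, e.s.Equiv (e'.s.value ν) := by
  let represented := {u | u ≤ e ∧ ∃ (c : (CSE.compactTree p choose fresh).Vertex) (ν : ℕ → ℕ),
    CSE.Represents e u c ν}
  have bot_mem : ⊥ ∈ represented :=
    ⟨bot_le, ⊥, fun _ => 0, CSE.Simulates.init e ⟨_, fun _ _ => rfl⟩⟩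
  obtain ⟨u, ⟨hue, c, ν, hu⟩, hmax⟩ :=
    ((CSE.ExecTree.Vertex.finite_Iic e).subset fun _ h => h.1).exists_maximal ⟨_, bot_mem⟩
  obtain rfl : u = e := by
    by_contra hne
    obtain ⟨v, huv, hve, hv⟩ := hu.exists_step hp hchoose hfresh he (hue.lt_of_ne hne)
    exact huv.not_ge (hmax ⟨hve, hv⟩ huv.le)
  exact ⟨c, hu.isLeaf hp he, ν, hu.equiv_value fun _ _ => rfl⟩

theorem mainTheorem1 {V : CSE.Vocab} (P : CSE.Program V)
    (p : Set (CSE.Template P)) (hp : ∀ t ∈ p, t.IsTemplate)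
    (choose : CSE.State P ℕ → List (CSE.State P ℕ) → CSE.Template P)
    (hchoose : ∀ s anc, (∃ t ∈ p, t.l = s.l) → choose s anc ∈ p ∧ (choose s anc).l = s.l)
    (fresh : CSE.State P ℕ → List (CSE.State P ℕ) → ℕ)
    (hfresh : ∀ u v : (CSE.compactTree p choose fresh).Vertex, u < v →
      CSE.Instantiates p u.s → CSE.Instantiates p v.s → fresh u.s u.anc ≠ fresh v.s v.anc)
    (e : (CSE.classicTree P).Vertex) (he : e.IsLeaf) :
    ∃ e' : (CSE.compactTree p choose fresh).Vertex, e'.IsLeaf ∧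
      ∃ ν : ℕ → ℕ, e.s.Equiv (e'.s.value ν) :=
  mainTheorem1_general P p (fun t ht => (hp t ht).isCover) choose hchoose fresh hfresh e he
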